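/- **Proposition (reversible entanglement decomposition of tensor powers of a tripartite state).** Let $c_1,c_2,c_3,c_4\in\mathbb R$ with $c_1^2+c_2^2+c_3^2+c_4^2=1$, and let $|\psi\rangle\in\mathbb C^6\otimes\mathbb C^6\otimes\mathbb C^6$ be the pure state of three parties $A,B,R$ (tensor factors in this order) $$|\psi\rangle=\tfrac{c_1}{\sqrt2}(|000\rangle+|101\rangle)+\tfrac{c_2}{\sqrt2}(|212\rangle+|223\rangle)+\tfrac{c_3}{\sqrt2}(|334\rangle+|444\rangle)+c_4|555\rangle .$$ Put $r_i=c_i^2$ for $i=1,2,3$ and $r_4=-\sum_{i=1}^4c_i^2\log_2c_i^2$ (with $0\log_2 0=0$), and for $n\ge0$ let $$|T_n\rangle=|\mathrm{EPR}\rangle_{AR}^{\otimes\lfloor r_1n\rfloor}\otimes|\mathrm{EPR}\rangle_{BR}^{\otimes\lfloor r_2n\rfloor}\otimes|\mathrm{EPR}\rangle_{AB}^{\otimes\lfloor r_3n\rfloor}\otimes|\mathrm{GHZ}\rangle_{ABR}^{\otimes\lfloor r_4n\rfloor},$$ where $|\mathrm{EPR}\rangle=(|00\rangle+|11\rangle)/\sqrt2$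 and $|\mathrm{GHZ}\rangle=(|000\rangle+|111\rangle)/\sqrt2$. Then $|\psi\rangle^{\otimes n}$ and $|T_n\rangle$ are asymptotically reversibly interconvertible by local operations and classical communication (LOCC) among $A$, $B$ and $R$. That is, there are integers $0\le s_n,s_n'\le n$ with $s_n/n\to0$ and $s'_n/n\to0$, and for every $n$ there are LOCC channels $\Lambda_n$ and $\Lambda_n'$ (finitely many rounds, in each of which one party applies a local quantum instrument and announces the outcome), such that, as $n\to\infty$, $$\big\|\Lambda_n\big[|\psi\rangle\langle\psi|^{\otimes n}\big]-|T_{n-s_n}\rangle\langle T_{n-s_n}|\big\|_1\to0,\qquad \big\|\Lambda_n'\big[|T_n\rangle\langle T_n|\big]-|\psi\rangle\langle\psi|^{\otimes(n-s_n')}\big\|_1\to0 .$$ -/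

import Mathlib

open scoped Matrix Kronecker

noncomputable section

/-- A finite-dimensional tripartite quantum system `A ⊗ B ⊗ R`. Each of the three local Hilbert
spaces has an orthonormal basis labelled by a finite type, so it is `ℂ^A`, `ℂ^B`, `ℂ^R`. -/
structure TriSystem where
  A : Type
  B : Type
  R : Type
  [fintypeA : Fintype A]
  [fintypeB : Fintype B]
  [fintypeR : Fintype R]
  [decEqA : DecidableEq A]
  [decEqB : DecidableEq B]
  [decEqR : DecidableEq R]

attribute [instance] TriSystem.fintypeA TriSystem.fintypeB TriSystem.fintypeR
  TriSystem.decEqA TriSystem.decEqB TriSystem.decEqR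

namespace TriSystem

/-- Labels of the product basis of `A ⊗ B ⊗ R`. -/
abbrev Idx (S : TriSystem) : Type := S.A × S.B × S.R

/-- Operators on `A ⊗ B ⊗ R`, as matrices in the product basis. -/
abbrev Op (S : TriSystem) : Type := Matrix S.Idx S.Idx ℂ

/-- The system `AA' ⊗ BB' ⊗ RR'`: each party holds its part of `S` and its part of `T`. -/
abbrev tensor (S T : TriSystem) : TriSystem where
  A := S.A × T.A
  B := S.B × T.B
  R := S.R × T.R

/-- The system `A^{⊗ n} ⊗ B^{⊗ n} ⊗ R^{⊗ n}`. -/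
abbrev pow (S : TriSystem) (n : ℕ) : TriSystem where
  A := Fin n → S.A
  B := Fin n → S.B
  R := Fin n → S.R

/-- The system `A₁ ⊗ B ⊗ R`, with the first local space replaced. -/
abbrev replaceA (S : TriSystem) (A₁ : Type) [Fintype A₁] [DecidableEq A₁] : TriSystem where
  A := A₁
  B := S.B
  R := S.R

/-- The system `A ⊗ B₁ ⊗ R`, with the second local space replaced. -/
abbrev replaceB (S : TriSystem) (B₁ : Type) [Fintype B₁] [DecidableEq B₁] : TriSystem where
  A := S.A
  B := B₁
  R := S.R

/-- The system `A ⊗ B ⊗ R₁`, with the third local space replaced. -/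
abbrev replaceR (S : TriSystem) (R₁ : Type) [Fintype R₁] [DecidableEq R₁] : TriSystem where
  A := S.A
  B := S.B
  R := R₁

end TriSystem

/-- A vector in a tripartite system, given by its coefficients in the product basis. -/
structure TriVector where
  sys : TriSystem
  vec : sys.Idx → ℂ

namespace TriVector

/-- `|φ⟩ ⊗ |χ⟩`, where each party holds its part of both vectors. -/
abbrev tensor (φ χ : TriVector) : TriVector where
  sys := φ.sys.tensor χ.sys
  vec := fun x => φ.vec (x.1.1, x.2.1.1, x.2.2.1) * χ.vec (x.1.2, x.2.1.2, x.2.2.2)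

/-- `|φ⟩^{⊗ n}`. -/
abbrev pow (φ : TriVector) (n : ℕ) : TriVector where
  sys := φ.sys.pow n
  vec := fun x => ∏ i, φ.vec (x.1 i, x.2.1 i, x.2.2 i)

/-- The operator `|φ⟩⟨φ|`. -/
def density (φ : TriVector) : φ.sys.Op := Matrix.vecMulVec φ.vec (star φ.vec)

end TriVector

/-- `LOCC T S` is the type of tripartite protocols with finitely many rounds from the system `S` to
the system `T` that use local operations and classical communication: in every round one of the
three parties applies a quantum instrument `(K x)_x`, `∑ x, (K x)ᴴ * K x = 1`, to its own system
and announces the outcome `x` to the other two parties; the rest of the protocol may depend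
on `x`. -/
inductive LOCC (T : TriSystem) : TriSystem → Type 1
  | done : LOCC T T
  | roundA {S : TriSystem} {X : Type} [Fintype X] {A₁ : Type} [Fintype A₁] [DecidableEq A₁]
      (K : X → Matrix A₁ S.A ℂ) (hK : ∑ x, (K x)ᴴ * K x = 1)
      (next : X → LOCC T (S.replaceA A₁)) : LOCC T S
  | roundB {S : TriSystem} {X : Type} [Fintype X] {B₁ : Type} [Fintype B₁] [DecidableEq B₁]
      (K : X → Matrix B₁ S.B ℂ) (hK : ∑ x, (K x)ᴴ * K x = 1)
      (next : X → LOCC T (S.replaceB B₁)) : LOCC T S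
  | roundR {S : TriSystem} {X : Type} [Fintype X] {R₁ : Type} [Fintype R₁] [DecidableEq R₁]
      (K : X → Matrix R₁ S.R ℂ) (hK : ∑ x, (K x)ᴴ * K x = 1)
      (next : X → LOCC T (S.replaceR R₁)) : LOCC T S

/-- The quantum channel that an LOCC protocol implements. A round of `A` with outcome `x` turns the
(unnormalised) state `ρ` into `(K x ⊗ 1 ⊗ 1) ρ (K x ⊗ 1 ⊗ 1)†`, and the final states of all branches
are added up; likewise for `B` and `R`. -/
def LOCC.apply {T : TriSystem} : {S : TriSystem} → LOCC T S → S.Op → T.Op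
  | _, .done, ρ => ρ
  | S, @LOCC.roundA _ _ _ _ _ _ _ K _ next, ρ =>
      ∑ x, (next x).apply
        ((K x ⊗ₖ ((1 : Matrix S.B S.B ℂ) ⊗ₖ (1 : Matrix S.R S.R ℂ))) * ρ *
          (K x ⊗ₖ ((1 : Matrix S.B S.B ℂ) ⊗ₖ (1 : Matrix S.R S.R ℂ)))ᴴ)
  | S, @LOCC.roundB _ _ _ _ _ _ _ K _ next, ρ =>
      ∑ x, (next x).apply
        (((1 : Matrix S.A S.A ℂ) ⊗ₖ (K x ⊗ₖ (1 : Matrix S.R S.R ℂ))) * ρ *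
          ((1 : Matrix S.A S.A ℂ) ⊗ₖ (K x ⊗ₖ (1 : Matrix S.R S.R ℂ)))ᴴ)
  | S, @LOCC.roundR _ _ _ _ _ _ _ K _ next, ρ =>
      ∑ x, (next x).apply
        (((1 : Matrix S.A S.A ℂ) ⊗ₖ ((1 : Matrix S.B S.B ℂ) ⊗ₖ K x)) * ρ *
          ((1 : Matrix S.A S.A ℂ) ⊗ₖ ((1 : Matrix S.B S.B ℂ) ⊗ₖ K x))ᴴ)

/-- The trace norm `‖M‖₁ = Tr √(M† M)`, the sum of the singular values of `M`. -/
def traceNorm {ι : Type*} [Fintype ι] [DecidableEq ι] (M : Matrix ι ι ℂ) : ℝ :=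
  ∑ i, √((Matrix.isHermitian_conjTranspose_mul_self M).eigenvalues i)

/-- The sequence of states `φ 0, φ 1, …` is asymptotically reducible to `χ 0, χ 1, …` by LOCC: up to
a sublinear loss `s n = o(n)` in the index, `φ n` is converted into `χ (n - s n)` with an error that
vanishes as `n → ∞`. -/
def AsympLOCCReducible (φ χ : ℕ → TriVector) : Prop :=
  ∃ s : ℕ → ℕ, (∀ n, s n ≤ n) ∧
    Filter.Tendsto (fun n => (s n : ℝ) / n) Filter.atTop (nhds 0) ∧
    ∃ Λ : (n : ℕ) → LOCC (χ (n - s n)).sys (φ n).sys,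
      Filter.Tendsto
        (fun n => traceNorm ((Λ n).apply (φ n).density - (χ (n - s n)).density))
        Filter.atTop (nhds 0)

/-- Asymptotically reversible LOCC conversion: it is possible in both directions. -/
def AsympLOCCReversible (φ χ : ℕ → TriVector) : Prop :=
  AsympLOCCReducible φ χ ∧ AsympLOCCReducible χ φ

/-- `(|00⟩ + |11⟩)/√2` shared by `A` and `R`; the space of `B` is one-dimensional. -/
abbrev eprAR : TriVector where
  sys := { A := Fin 2, B := Unit, R := Fin 2 }
  vec := fun x => if x.1 = x.2.2 then ((1 / √2 : ℝ) : ℂ) else 0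

/-- `(|00⟩ + |11⟩)/√2` shared by `B` and `R`; the space of `A` is one-dimensional. -/
abbrev eprBR : TriVector where
  sys := { A := Unit, B := Fin 2, R := Fin 2 }
  vec := fun x => if x.2.1 = x.2.2 then ((1 / √2 : ℝ) : ℂ) else 0

/-- `(|00⟩ + |11⟩)/√2` shared by `A` and `B`; the space of `R` is one-dimensional. -/
abbrev eprAB : TriVector where
  sys := { A := Fin 2, B := Fin 2, R := Unit }
  vec := fun x => if x.1 = x.2.1 then ((1 / √2 : ℝ) : ℂ) else 0

/-- `(|000⟩ + |111⟩)/√2` shared by `A`, `B` and `R`. -/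
abbrev ghzABR : TriVector where
  sys := { A := Fin 2, B := Fin 2, R := Fin 2 }
  vec := fun x => if x.1 = x.2.1 ∧ x.2.1 = x.2.2 then ((1 / √2 : ℝ) : ℂ) else 0

/-- The basis vector `|i j k⟩` of `ℂ⁶ ⊗ ℂ⁶ ⊗ ℂ⁶`. -/
def ket (i j k : Fin 6) : Fin 6 × Fin 6 × Fin 6 → ℂ := Pi.single (i, j, k) 1

/-- The vector
`c₁ (|000⟩ + |101⟩)/√2 + c₂ (|212⟩ + |223⟩)/√2 + c₃ (|334⟩ + |444⟩)/√2 + c₄ |555⟩`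
of `ℂ⁶ ⊗ ℂ⁶ ⊗ ℂ⁶`, with the tensor factors in the order `A`, `B`, `R`. -/
abbrev psi (c₁ c₂ c₃ c₄ : ℝ) : TriVector where
  sys := { A := Fin 6, B := Fin 6, R := Fin 6 }
  vec := ((c₁ * (1 / √2) : ℝ) : ℂ) • (ket 0 0 0 + ket 1 0 1)
    + ((c₂ * (1 / √2) : ℝ) : ℂ) • (ket 2 1 2 + ket 2 2 3)
    + ((c₃ * (1 / √2) : ℝ) : ℂ) • (ket 3 3 4 + ket 4 4 4)
    + (c₄ : ℂ) • ket 5 5 5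

/-- `EPR_AR^{⊗ ⌊r₁ n⌋} ⊗ EPR_BR^{⊗ ⌊r₂ n⌋} ⊗ EPR_AB^{⊗ ⌊r₃ n⌋} ⊗ GHZ_ABR^{⊗ ⌊r₄ n⌋}`. -/
def eprGhz (r₁ r₂ r₃ r₄ : ℝ) (n : ℕ) : TriVector :=
  (((eprAR.pow ⌊r₁ * n⌋₊).tensor (eprBR.pow ⌊r₂ * n⌋₊)).tensor
    (eprAB.pow ⌊r₃ * n⌋₊)).tensor (ghzABR.pow ⌊r₄ * n⌋₊)

end

/-! Grouping the terms of ψ^{⊗n} by the sequence x of blocks gives ∑ a(x) |x y₁ y₃⟩|x y₂ y₃⟩|x y₁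
y₂⟩, where y₁, y₂, y₃ are bit strings that are free at the positions of x in the blocks 0, 1, 2 and
zero elsewhere. All three parties hold x, so the superposition over x is of GHZ type; each bit
string is held by exactly two parties and consists of EPR pairs. T_n has the same form with constant
amplitude. `IsFamily` records this form, and the problem reduces to comparing sizes of index sets
and amplitudes.

One exact conversion, `Reach.family`, serves both directions: a family with constant amplitude can
be turned into any normalised family with no larger index sets. A register is viewed as a cyclic
group and one of its holders applies the Kraus operators |x⟩ ↦ b(x + j)|x + j⟩. Since the amplitude
is translation invariant, outcome j imposes the amplitude b up to a translation of the labels of the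
other parties, which they carry out once j is announced (`Reach.shiftA`, `Reach.shiftB`).

For distillation, A measures the type of x. Sequences of one type have equal amplitudes and equal
numbers of free bits, so a family with constant amplitude remains and is converted into the target
(`reach_psiType`); the error is at most twice the probability of the bad types. For dilution, T_n is
converted into the normalised restriction of ψ^{⊗(n-s)} to typical sequences, and the overlap with
the full vector bounds the error.

Chebyshev's inequality keeps the block counts within n^{3/4} of their means. The logarithm of a
sequence probability is linear in the counts, hence within O(n^{3/4}) of -nH, which bounds the
number of typical sequences from above. There are at most (n+1)^4 types, so types of probability
below (n+1)^{-5} are negligible, and every other typical class has at least 2^{nH - O(n^{3/4}) - 5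
log₂(n+1)} elements. A loss of order n^{7/8} absorbs all these corrections. -/

noncomputable section

/-! ### Protocols on pure inputs and monomial Kraus operators -/

namespace LOCC

theorem apply_smul {T S : TriSystem} (Λ : LOCC T S) (c : ℂ) (ρ : S.Op) :
    Λ.apply (c • ρ) = c • Λ.apply ρ := by
  induction Λ with
  | done => rfl
  | roundA K hK next ih =>
    simp only [LOCC.apply, Matrix.mul_smul, Matrix.smul_mul, ih, Finset.smul_sum]
  | roundB K hK next ih =>
    simp only [LOCC.apply, Matrix.mul_smul, Matrix.smul_mul, ih, Finset.smul_sum]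
  | roundR K hK next ih =>
    simp only [LOCC.apply, Matrix.mul_smul, Matrix.smul_mul, ih, Finset.smul_sum]

theorem apply_zero {T S : TriSystem} (Λ : LOCC T S) : Λ.apply 0 = 0 := by
  simpa using Λ.apply_smul 0 0

end LOCC

/-- The rank-one operator `|v⟩⟨v|`. -/
def outer {ι : Type*} (v : ι → ℂ) : Matrix ι ι ℂ := Matrix.vecMulVec v (star v)

theorem outer_smul {ι : Type*} (c : ℂ) (v : ι → ℂ) :
    outer (c • v) = (c * star c) • outer v := by
  ext i j
  simp [outer, Matrix.vecMulVec_apply]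
  ring

theorem outer_zero {ι : Type*} : outer (0 : ι → ℂ) = 0 := by
  ext i j
  simp [outer, Matrix.vecMulVec_apply]

theorem mul_outer_mul {ι κ : Type*} [Fintype ι] (M : Matrix κ ι ℂ) (v : ι → ℂ) :
    M * outer v * Mᴴ = outer (M *ᵥ v) := by
  rw [outer, outer, Matrix.mul_vecMulVec, Matrix.vecMulVec_mul, Matrix.star_mulVec]

/-- The operator `σ` is the output of some LOCC protocol on the input `|v⟩⟨v|`. -/
def Reach {S : TriSystem} (v : S.Idx → ℂ) (T : TriSystem) (σ : T.Op) : Prop :=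
  ∃ Λ : LOCC T S, Λ.apply (outer v) = σ

namespace Reach

variable {S T : TriSystem}

theorem done (v : S.Idx → ℂ) : Reach v S (outer v) := ⟨LOCC.done, rfl⟩

theorem smul {v : S.Idx → ℂ} {σ : T.Op} (h : Reach v T σ) (c : ℂ) :
    Reach (c • v) T ((c * star c) • σ) := by
  obtain ⟨Λ, rfl⟩ := h
  exact ⟨Λ, by rw [outer_smul, Λ.apply_smul]⟩

theorem zero {v : S.Idx → ℂ} {σ : T.Op} (h : Reach v T σ) :
    Reach (0 : S.Idx → ℂ) T 0 := by
  obtain ⟨Λ, rfl⟩ := h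
  exact ⟨Λ, by rw [outer_zero, Λ.apply_zero]⟩

end Reach

/-- The operator `∑ a, k a |f a⟩⟨a|`. -/
def monomialOp {A A₁ : Type*} [DecidableEq A₁] (f : A → A₁) (k : A → ℂ) : Matrix A₁ A ℂ :=
  Matrix.of fun a₁ a => if f a = a₁ then k a else 0

/-- The (a, a') entry of K†K is star (k a) * k a' when f a = f a' and 0 otherwise, so completeness
of the instrument becomes a scalar identity. -/
theorem sum_monomialOp {A A₁ X : Type*} [Fintype A₁] [DecidableEq A₁] [DecidableEq A] [Fintype X]
    {f : X → A → A₁} {k : X → A → ℂ}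
    (h : ∀ a a', ∑ x, (if f x a = f x a' then star (k x a) * k x a' else 0) =
      if a = a' then 1 else 0) :
    ∑ x, (monomialOp (f x) (k x))ᴴ * monomialOp (f x) (k x) = 1 := by
  ext a a'
  rw [Matrix.sum_apply, Matrix.one_apply, ← h a a']
  refine Finset.sum_congr rfl fun x _ => ?_
  simp only [monomialOp, Matrix.mul_apply, Matrix.conjTranspose_apply, Matrix.of_apply]
  rw [Finset.sum_eq_single (f x a)]
  · by_cases hx : f x a = f x a'
    · simp [hx]
    · simp [hx, Ne.symm hx]
  · intro b _ hb
    simp [hb.symm]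
  · simp

namespace Reach

variable {S T : TriSystem} {X : Type} [Fintype X]

theorem roundA {A₁ : Type} [Fintype A₁] [DecidableEq A₁] {v : S.Idx → ℂ} {σ : X → T.Op}
    (f : X → S.A → A₁) (k : X → S.A → ℂ)
    (h : ∀ a a', ∑ x, (if f x a = f x a' then star (k x a) * k x a' else 0) =
      if a = a' then 1 else 0)
    (hv : ∀ x, Reach (S := S.replaceA A₁)
      (fun p => ∑ a, if f x a = p.1 then k x a * v (a, p.2) else 0) T (σ x)) :
    Reach v T (∑ x, σ x) := by
  choose Λ hΛ using hv
  refine ⟨LOCC.roundA (fun x => monomialOp (f x) (k x)) (sum_monomialOp h) Λ, ?_⟩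
  simp only [LOCC.apply, mul_outer_mul, ← hΛ]
  congr! 3 with x
  funext ⟨a, b, r⟩
  simp [Matrix.mulVec, dotProduct, Fintype.sum_prod_type, Matrix.one_apply, monomialOp]

theorem roundB {B₁ : Type} [Fintype B₁] [DecidableEq B₁] {v : S.Idx → ℂ} {σ : X → T.Op}
    (f : X → S.B → B₁) (k : X → S.B → ℂ)
    (h : ∀ a a', ∑ x, (if f x a = f x a' then star (k x a) * k x a' else 0) =
      if a = a' then 1 else 0)
    (hv : ∀ x, Reach (S := S.replaceB B₁)
      (fun p => ∑ b, if f x b = p.2.1 then k x b * v (p.1, b, p.2.2) else 0) T (σ x)) :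
    Reach v T (∑ x, σ x) := by
  choose Λ hΛ using hv
  refine ⟨LOCC.roundB (fun x => monomialOp (f x) (k x)) (sum_monomialOp h) Λ, ?_⟩
  simp only [LOCC.apply, mul_outer_mul, ← hΛ]
  congr! 3 with x
  funext ⟨a, b, r⟩
  simp [Matrix.mulVec, dotProduct, Fintype.sum_prod_type, Matrix.one_apply, monomialOp]
  rw [Finset.sum_eq_single a (fun _ _ hx => by simp [hx.symm]) (by simp)]
  simp

theorem roundR {R₁ : Type} [Fintype R₁] [DecidableEq R₁] {v : S.Idx → ℂ} {σ : X → T.Op}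
    (f : X → S.R → R₁) (k : X → S.R → ℂ)
    (h : ∀ a a', ∑ x, (if f x a = f x a' then star (k x a) * k x a' else 0) =
      if a = a' then 1 else 0)
    (hv : ∀ x, Reach (S := S.replaceR R₁)
      (fun p => ∑ r, if f x r = p.2.2 then k x r * v (p.1, p.2.1, r) else 0) T (σ x)) :
    Reach v T (∑ x, σ x) := by
  choose Λ hΛ using hv
  refine ⟨LOCC.roundR (fun x => monomialOp (f x) (k x)) (sum_monomialOp h) Λ, ?_⟩
  simp only [LOCC.apply, mul_outer_mul, ← hΛ]
  congr! 3 with x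
  funext ⟨a, b, r⟩
  simp [Matrix.mulVec, dotProduct, Fintype.sum_prod_type, Matrix.one_apply, monomialOp]
  rw [Finset.sum_eq_single a (fun _ _ hx => by simp [hx.symm]) (by simp),
    Finset.sum_eq_single b (fun _ _ hx => by simp [hx.symm]) (by simp)]
  simp

/-- Every party measures its system and prepares a fixed basis state. -/
theorem discard (v : S.Idx → ℂ) (T : TriSystem) (e : T.Idx) :
    Reach v T ((star v ⬝ᵥ v) • outer (Pi.single e 1)) := by
  rw [dotProduct_comm]
  have key : ∀ (ι κ : Type) [Fintype ι] [DecidableEq ι] [DecidableEq κ] (c : κ) (a a' : ι),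
      ∑ x, (if (fun _ _ => c : ι → ι → κ) x a = (fun _ _ => c : ι → ι → κ) x a' then
        star ((Pi.single x 1 : ι → ℂ) a) * (Pi.single x 1 : ι → ℂ) a' else 0) =
      if a = a' then 1 else 0 := by
    intro ι κ _ _ _ c a a'
    simp [Pi.single_apply, apply_ite, eq_comm]
  have hsum : (v ⬝ᵥ star v) • outer (Pi.single e 1 : T.Idx → ℂ) =
      ∑ a, ∑ b, ∑ r, (v (a, b, r) * star (v (a, b, r))) • outer (Pi.single e 1 : T.Idx → ℂ) := by
    simp only [dotProduct, Fintype.sum_prod_type, Finset.sum_smul, Pi.star_apply]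
  rw [hsum]
  refine roundA (A₁ := T.A) (fun _ _ => e.1) (fun x => Pi.single x 1) (key _ _ _) fun a => ?_
  refine roundB (B₁ := T.B) (fun _ _ => e.2.1) (fun x => Pi.single x 1) (key _ _ _) fun b => ?_
  refine roundR (R₁ := T.R) (fun _ _ => e.2.2) (fun x => Pi.single x 1) (key _ _ _) fun r => ?_
  refine ⟨LOCC.done, ?_⟩
  rw [← outer_smul]
  simp only [LOCC.apply]
  congr 1
  funext ⟨a', b', r'⟩
  obtain ⟨ea, eb, er⟩ := e
  by_cases h1 : ea = a' <;> by_cases h2 : eb = b' <;> by_cases h3 : er = r' <;>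
    simp [Pi.single_apply, h1, h2, h3, Prod.ext_iff, eq_comm] <;> grind

end Reach

/-! ### Vectors given by labelled terms -/

/-- The vector `∑ ω ∈ s, w ω |α ω⟩|β ω⟩|ρ ω⟩`. -/
def labelled {S : TriSystem} {Ω : Type} (s : Finset Ω) (α : Ω → S.A) (β : Ω → S.B) (ρ : Ω → S.R)
    (w : Ω → ℂ) : S.Idx → ℂ :=
  fun p => ∑ ω ∈ s, if α ω = p.1 ∧ β ω = p.2.1 ∧ ρ ω = p.2.2 then w ω else 0

section labelled

variable {S T : TriSystem} {Ω : Type} {s : Finset Ω} {α : Ω → S.A} {β : Ω → S.B} {ρ : Ω → S.R}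
  {w : Ω → ℂ}

theorem labelled_congr {α' : Ω → S.A} {β' : Ω → S.B} {ρ' : Ω → S.R} {w' : Ω → ℂ}
    (hα : ∀ ω ∈ s, α ω = α' ω) (hβ : ∀ ω ∈ s, β ω = β' ω) (hρ : ∀ ω ∈ s, ρ ω = ρ' ω)
    (hw : ∀ ω ∈ s, w ω = w' ω) :
    labelled s α β ρ w = labelled s α' β' ρ' w' := by
  funext p
  refine Finset.sum_congr rfl fun ω h => ?_
  rw [hα ω h, hβ ω h, hρ ω h, hw ω h]

theorem labelled_smul (c : ℂ) :
    labelled s α β ρ (fun ω => c * w ω) = c • labelled s α β ρ w := by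
  funext p
  simp [labelled, Finset.mul_sum]

theorem labelled_eq_zero (hw : ∀ ω ∈ s, w ω = 0) : labelled s α β ρ w = 0 := by
  funext p
  exact Finset.sum_eq_zero fun ω h => by simp [hw ω h]

theorem labelled_reindex {Ω' : Type} {t : Finset Ω'} (e : Ω' → Ω) (he : Set.BijOn e t s) :
    labelled s α β ρ w =
      labelled t (fun ω => α (e ω)) (fun ω => β (e ω)) (fun ω => ρ (e ω)) (fun ω => w (e ω)) := by
  funext p
  exact (Finset.sum_nbij e (fun _ h => he.mapsTo h) he.injOn he.surjOn fun _ _ => rfl).symm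

theorem labelled_filter (P : Ω → Prop) [DecidablePred P] :
    labelled (s.filter P) α β ρ w = labelled s α β ρ (fun ω => if P ω then w ω else 0) := by
  funext p
  simp only [labelled, Finset.sum_filter]
  refine Finset.sum_congr rfl fun ω _ => ?_
  split_ifs <;> rfl

theorem labelled_apply (hinj : ∀ ω ∈ s, ∀ ω' ∈ s, α ω = α ω' → β ω = β ω' → ρ ω = ρ ω' → ω = ω')
    {ω : Ω} (hω : ω ∈ s) : labelled s α β ρ w (α ω, β ω, ρ ω) = w ω := by
  unfold labelled
  rw [Finset.sum_eq_single_of_mem ω hω]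
  · simp
  · intro ω' h' hne
    rw [if_neg]
    rintro ⟨h1, h2, h3⟩
    exact hne (hinj _ h' _ hω h1 h2 h3)

theorem labelled_sum_mul (u : S.Idx → ℂ) :
    ∑ p, u p * labelled s α β ρ w p = ∑ ω ∈ s, u (α ω, β ω, ρ ω) * w ω := by
  simp only [labelled, Finset.mul_sum]
  rw [Finset.sum_comm]
  refine Finset.sum_congr rfl fun ω _ => ?_
  rw [Finset.sum_eq_single (α ω, β ω, ρ ω)]
  · simp
  · rintro ⟨a, b, r⟩ _ hne
    rw [if_neg, mul_zero]
    rintro ⟨h1, h2, h3⟩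
    exact hne (by rw [h1, h2, h3])
  · simp

/-- By `hinj` distinct indices give distinct, hence orthonormal, product basis vectors. -/
theorem labelled_inner {t : Finset Ω} {w' : Ω → ℂ} (hts : t ⊆ s)
    (hinj : ∀ ω ∈ s, ∀ ω' ∈ s, α ω = α ω' → β ω = β ω' → ρ ω = ρ ω' → ω = ω') :
    ∑ p, star (labelled s α β ρ w p) * labelled t α β ρ w' p = ∑ ω ∈ t, star (w ω) * w' ω := by
  rw [labelled_sum_mul (fun p => star (labelled s α β ρ w p))]
  exact Finset.sum_congr rfl fun ω h => by rw [labelled_apply hinj (hts h)]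

end labelled

/-! ### Local operations on labelled vectors -/

namespace Reach

variable {S T : TriSystem} {Ω : Type} {s : Finset Ω} {α : Ω → S.A} {β : Ω → S.B} {ρ : Ω → S.R}
  {w : Ω → ℂ} {X : Type} [Fintype X]

theorem labelledA {A₁ : Type} [Fintype A₁] [DecidableEq A₁] {σ : X → T.Op}
    (f : X → S.A → A₁) (k : X → S.A → ℂ)
    (h : ∀ a a', ∑ x, (if f x a = f x a' then star (k x a) * k x a' else 0) =
      if a = a' then 1 else 0)
    (hv : ∀ x, Reach (S := S.replaceA A₁)
      (labelled s (fun ω => f x (α ω)) β ρ (fun ω => k x (α ω) * w ω)) T (σ x)) :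
    Reach (labelled s α β ρ w) T (∑ x, σ x) := by
  refine roundA f k h fun x => ?_
  convert hv x using 1
  funext ⟨a₁, b, r⟩
  simp only [labelled, Finset.mul_sum]
  simp only [← Finset.sum_filter]
  rw [Finset.sum_comm]
  simp only [Finset.sum_filter]
  refine Finset.sum_congr rfl fun ω _ => ?_
  rw [Finset.sum_eq_single (α ω) (fun a _ ha => by simp [ha.symm]) (by simp)]
  by_cases h1 : f x (α ω) = a₁ <;> simp [h1]

theorem labelledB {B₁ : Type} [Fintype B₁] [DecidableEq B₁] {σ : X → T.Op}
    (f : X → S.B → B₁) (k : X → S.B → ℂ)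
    (h : ∀ a a', ∑ x, (if f x a = f x a' then star (k x a) * k x a' else 0) =
      if a = a' then 1 else 0)
    (hv : ∀ x, Reach (S := S.replaceB B₁)
      (labelled s α (fun ω => f x (β ω)) ρ (fun ω => k x (β ω) * w ω)) T (σ x)) :
    Reach (labelled s α β ρ w) T (∑ x, σ x) := by
  refine roundB f k h fun x => ?_
  convert hv x using 1
  funext ⟨a, b₁, r⟩
  simp only [labelled, Finset.mul_sum]
  simp only [← Finset.sum_filter]
  rw [Finset.sum_comm]
  simp only [Finset.sum_filter]
  refine Finset.sum_congr rfl fun ω _ => ?_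
  rw [Finset.sum_eq_single (β ω) (fun a _ ha => by simp [ha.symm]) (by simp)]
  by_cases h1 : f x (β ω) = b₁ <;> simp [h1]

theorem labelledR {R₁ : Type} [Fintype R₁] [DecidableEq R₁] {σ : X → T.Op}
    (f : X → S.R → R₁) (k : X → S.R → ℂ)
    (h : ∀ a a', ∑ x, (if f x a = f x a' then star (k x a) * k x a' else 0) =
      if a = a' then 1 else 0)
    (hv : ∀ x, Reach (S := S.replaceR R₁)
      (labelled s α β (fun ω => f x (ρ ω)) (fun ω => k x (ρ ω) * w ω)) T (σ x)) :
    Reach (labelled s α β ρ w) T (∑ x, σ x) := by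
  refine roundR f k h fun x => ?_
  convert hv x using 1
  funext ⟨a, b, r₁⟩
  simp only [labelled, Finset.mul_sum]
  simp only [← Finset.sum_filter]
  rw [Finset.sum_comm]
  simp only [Finset.sum_filter]
  refine Finset.sum_congr rfl fun ω _ => ?_
  rw [Finset.sum_eq_single (ρ ω) (fun a _ ha => by simp [ha.symm]) (by simp)]
  by_cases h1 : f x (ρ ω) = r₁ <;> simp [h1]

/-- The labels in use are carried to the new ones by an injection, so outcome `none` is a partial
isometry. Outcome `some x` projects onto an unused label x; these outcomes only complete the
instrument and never occur on the given vector. No inequality between the dimensions of the two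
spaces is needed. -/
theorem exists_relabelling {A A₁ : Type} [Fintype A] [DecidableEq A] [DecidableEq A₁]
    (hs : s.Nonempty) {α : Ω → A} {α' : Ω → A₁}
    (hα : ∀ ω ∈ s, ∀ ω' ∈ s, (α ω = α ω' ↔ α' ω = α' ω')) :
    ∃ (f : A → A₁) (k : Option A → A → ℂ),
      (∀ a a', ∑ x, (if f a = f a' then star (k x a) * k x a' else 0) = if a = a' then 1 else 0) ∧
      (∀ ω ∈ s, f (α ω) = α' ω) ∧ (∀ ω ∈ s, k none (α ω) = 1) ∧
      ∀ x, ∀ ω ∈ s, k (some x) (α ω) = 0 := by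
  classical
  let P : A → Prop := fun a => ∃ ω ∈ s, α ω = a
  have hP : ∀ ω ∈ s, P (α ω) := fun ω h => ⟨ω, h, rfl⟩
  let f : A → A₁ := fun a => if h : P a then α' h.choose else α' hs.choose
  have hf : ∀ ω ∈ s, f (α ω) = α' ω := by
    intro ω h
    have hc := (hP ω h).choose_spec
    simp only [f, dif_pos (hP ω h)]
    exact (hα _ hc.1 _ h).1 hc.2
  refine ⟨f, fun x a => x.elim (if P a then 1 else 0) (fun y => if a = y ∧ ¬ P a then 1 else 0),
    ?_, hf, fun ω h => by simp [hP ω h], fun x ω h => by simp [hP ω h]⟩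
  intro a a'
  by_cases ha : P a
  · by_cases ha' : P a'
    · obtain ⟨ω, h, rfl⟩ := ha
      obtain ⟨ω', h', rfl⟩ := ha'
      have := hα ω h ω' h'
      simp [Fintype.sum_option, hP ω h, hP ω' h', hf ω h, hf ω' h', this]
    · have : a ≠ a' := fun e => ha' (e ▸ ha)
      simp [Fintype.sum_option, ha, ha', this]
  · by_cases ha' : P a'
    · have : a ≠ a' := fun e => ha (e ▸ ha')
      simp [Fintype.sum_option, ha, ha', this]
    · by_cases h : a = a'
      · subst h
        simp [Fintype.sum_option, ha, apply_ite]
      · have : ∀ x, ¬ (a = x ∧ a' = x) := fun x hx => h (hx.1.trans hx.2.symm)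
        simp only [Fintype.sum_option, Option.elim, ha, ha', h]
        refine (congrArg₂ _ (by simp) (Finset.sum_eq_zero fun x _ => ?_)).trans (add_zero 0)
        have := this x
        by_cases h1 : a = x <;> by_cases h2 : a' = x <;> simp_all

theorem relabelA {A₁ : Type} [Fintype A₁] [DecidableEq A₁] {σ : T.Op} (hs : s.Nonempty)
    {α' : Ω → A₁} (hα : ∀ ω ∈ s, ∀ ω' ∈ s, (α ω = α ω' ↔ α' ω = α' ω'))
    (h : Reach (S := S.replaceA A₁) (labelled s α' β ρ w) T σ) :
    Reach (labelled s α β ρ w) T σ := by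
  obtain ⟨f, k, hk, hf, h1, h0⟩ := exists_relabelling hs hα
  have := labelledA (S := S) (T := T) (s := s) (α := α) (β := β) (ρ := ρ) (w := w)
    (σ := fun x : Option S.A => x.elim σ (fun _ => 0)) (fun _ => f) k hk (fun x => ?_)
  · simpa [Fintype.sum_option] using this
  · cases x with
    | none =>
      rwa [labelled_congr (α' := α') (w' := w) hf (fun _ _ => rfl) (fun _ _ => rfl)
        (fun ω hω => by rw [h1 ω hω, one_mul])]
    | some y =>
      rw [labelled_eq_zero fun ω hω => by rw [h0 y ω hω, zero_mul]]
      exact h.zero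

theorem relabelB {B₁ : Type} [Fintype B₁] [DecidableEq B₁] {σ : T.Op} (hs : s.Nonempty)
    {β' : Ω → B₁} (hβ : ∀ ω ∈ s, ∀ ω' ∈ s, (β ω = β ω' ↔ β' ω = β' ω'))
    (h : Reach (S := S.replaceB B₁) (labelled s α β' ρ w) T σ) :
    Reach (labelled s α β ρ w) T σ := by
  obtain ⟨f, k, hk, hf, h1, h0⟩ := exists_relabelling hs hβ
  have := labelledB (S := S) (T := T) (s := s) (α := α) (β := β) (ρ := ρ) (w := w)
    (σ := fun x : Option S.B => x.elim σ (fun _ => 0)) (fun _ => f) k hk (fun x => ?_)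
  · simpa [Fintype.sum_option] using this
  · cases x with
    | none =>
      rwa [labelled_congr (β' := β') (w' := w) (fun _ _ => rfl) hf (fun _ _ => rfl)
        (fun ω hω => by rw [h1 ω hω, one_mul])]
    | some y =>
      rw [labelled_eq_zero fun ω hω => by rw [h0 y ω hω, zero_mul]]
      exact h.zero

theorem relabelR {R₁ : Type} [Fintype R₁] [DecidableEq R₁] {σ : T.Op} (hs : s.Nonempty)
    {ρ' : Ω → R₁} (hρ : ∀ ω ∈ s, ∀ ω' ∈ s, (ρ ω = ρ ω' ↔ ρ' ω = ρ' ω'))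
    (h : Reach (S := S.replaceR R₁) (labelled s α β ρ' w) T σ) :
    Reach (labelled s α β ρ w) T σ := by
  obtain ⟨f, k, hk, hf, h1, h0⟩ := exists_relabelling hs hρ
  have := labelledR (S := S) (T := T) (s := s) (α := α) (β := β) (ρ := ρ) (w := w)
    (σ := fun x : Option S.R => x.elim σ (fun _ => 0)) (fun _ => f) k hk (fun x => ?_)
  · simpa [Fintype.sum_option] using this
  · cases x with
    | none =>
      rwa [labelled_congr (ρ' := ρ') (w' := w) (fun _ _ => rfl) (fun _ _ => rfl) hf
        (fun ω hω => by rw [h1 ω hω, one_mul])]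
    | some y =>
      rw [labelled_eq_zero fun ω hω => by rw [h0 y ω hω, zero_mul]]
      exact h.zero

/-- Up to local operations, a labelled vector depends only on which labels coincide. -/
theorem relabel {S' : TriSystem} {σ : T.Op} (hs : s.Nonempty)
    {α' : Ω → S'.A} {β' : Ω → S'.B} {ρ' : Ω → S'.R}
    (hα : ∀ ω ∈ s, ∀ ω' ∈ s, (α ω = α ω' ↔ α' ω = α' ω'))
    (hβ : ∀ ω ∈ s, ∀ ω' ∈ s, (β ω = β ω' ↔ β' ω = β' ω'))
    (hρ : ∀ ω ∈ s, ∀ ω' ∈ s, (ρ ω = ρ ω' ↔ ρ' ω = ρ' ω'))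
    (h : Reach (labelled s α' β' ρ' w) T σ) :
    Reach (labelled s α β ρ w) T σ :=
  relabelA hs hα (relabelB hs hβ (relabelR hs hρ h))

theorem sum_shift {A J : Type} [Fintype J] [DecidableEq A] {g : J → A → A}
    (hg : ∀ j, Function.Injective (g j)) {b : A → ℂ}
    (hb : ∀ a, ∑ j, star (b (g j a)) * b (g j a) = 1) (a a' : A) :
    ∑ j, (if g j a = g j a' then star (b (g j a)) * b (g j a') else 0) =
      if a = a' then 1 else 0 := by
  by_cases h : a = a'
  · subst h
    simpa using hb a
  · simp [h, (hg _).eq_iff]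

/-- Outcome j multiplies the term ω by b (α (τ j ω)) and moves the label of A to α (τ j ω). Once B
and R relabel by τ j as well, substituting τ j ω for ω gives the vector with weights b (α ω) * w ω,
because w is invariant. All outcomes thus lead to the same unnormalised vector, whence the factor
`Fintype.card J`. -/
theorem shiftA {σ : T.Op} [Fintype Ω] [Nonempty Ω] {J : Type} [Fintype J] (τ : J → Ω ≃ Ω)
    (g : J → S.A → S.A) (hg : ∀ j, Function.Injective (g j)) (b : S.A → ℂ)
    (hb : ∀ a, ∑ j, star (b (g j a)) * b (g j a) = 1)
    (hα : ∀ j ω, α (τ j ω) = g j (α ω))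
    (hβ : ∀ j ω ω', β ω = β ω' ↔ β (τ j ω) = β (τ j ω'))
    (hρ : ∀ j ω ω', ρ ω = ρ ω' ↔ ρ (τ j ω) = ρ (τ j ω'))
    (hw : ∀ j ω, w (τ j ω) = w ω)
    (h : Reach (labelled Finset.univ α β ρ (fun ω => b (α ω) * w ω)) T σ) :
    Reach (labelled Finset.univ α β ρ w) T ((Fintype.card J : ℂ) • σ) := by
  have := labelledA (S := S) (T := T) (s := Finset.univ) (α := α) (β := β) (ρ := ρ) (w := w)
    (σ := fun _ : J => σ) g (fun j a => b (g j a)) (sum_shift hg hb) (fun j => ?_)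
  · simpa [← Nat.cast_smul_eq_nsmul ℂ] using this
  · rw [labelled_reindex (τ j) (t := Finset.univ) (by simp)] at h
    refine relabel (S := S) Finset.univ_nonempty (fun ω _ ω' _ => ?_) (fun ω _ ω' _ => hβ j ω ω')
      (fun ω _ ω' _ => hρ j ω ω') ?_ (α' := fun ω => α (τ j ω))
    · rw [hα, hα]
    · simpa only [hα, hw] using h

theorem shiftB {σ : T.Op} [Fintype Ω] [Nonempty Ω] {J : Type} [Fintype J] (τ : J → Ω ≃ Ω)
    (g : J → S.B → S.B) (hg : ∀ j, Function.Injective (g j)) (b : S.B → ℂ)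
    (hb : ∀ a, ∑ j, star (b (g j a)) * b (g j a) = 1)
    (hβ : ∀ j ω, β (τ j ω) = g j (β ω))
    (hα : ∀ j ω ω', α ω = α ω' ↔ α (τ j ω) = α (τ j ω'))
    (hρ : ∀ j ω ω', ρ ω = ρ ω' ↔ ρ (τ j ω) = ρ (τ j ω'))
    (hw : ∀ j ω, w (τ j ω) = w ω)
    (h : Reach (labelled Finset.univ α β ρ (fun ω => b (β ω) * w ω)) T σ) :
    Reach (labelled Finset.univ α β ρ w) T ((Fintype.card J : ℂ) • σ) := by
  have := labelledB (S := S) (T := T) (s := Finset.univ) (α := α) (β := β) (ρ := ρ) (w := w)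
    (σ := fun _ : J => σ) g (fun j a => b (g j a)) (sum_shift hg hb) (fun j => ?_)
  · simpa [← Nat.cast_smul_eq_nsmul ℂ] using this
  · rw [labelled_reindex (τ j) (t := Finset.univ) (by simp)] at h
    refine relabel (S := S) Finset.univ_nonempty (fun ω _ ω' _ => hα j ω ω') (fun ω _ ω' _ => ?_)
      (fun ω _ ω' _ => hρ j ω ω') ?_ (β' := fun ω => β (τ j ω))
    · rw [hβ, hβ]
    · simpa only [hβ, hw] using h

end Reach

/-! ### Families: a GHZ-type index shared by all and three indices shared by pairs -/

section Family

variable {X Y₁ Y₂ Y₃ : Type}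

/-- On `s`, the label of `A` identifies `(x, y₁, y₃)`, that of `B` identifies `(x, y₂, y₃)` and
that of `R` identifies `(x, y₁, y₂)`. -/
structure IsFamily {S : TriSystem} (s : Finset (X × Y₁ × Y₂ × Y₃)) (α : X × Y₁ × Y₂ × Y₃ → S.A)
    (β : X × Y₁ × Y₂ × Y₃ → S.B) (ρ : X × Y₁ × Y₂ × Y₃ → S.R) : Prop where
  A : ∀ ω ∈ s, ∀ ω' ∈ s, (α ω = α ω' ↔ ω.1 = ω'.1 ∧ ω.2.1 = ω'.2.1 ∧ ω.2.2.2 = ω'.2.2.2)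
  B : ∀ ω ∈ s, ∀ ω' ∈ s, (β ω = β ω' ↔ ω.1 = ω'.1 ∧ ω.2.2.1 = ω'.2.2.1 ∧ ω.2.2.2 = ω'.2.2.2)
  R : ∀ ω ∈ s, ∀ ω' ∈ s, (ρ ω = ρ ω' ↔ ω.1 = ω'.1 ∧ ω.2.1 = ω'.2.1 ∧ ω.2.2.1 = ω'.2.2.1)

variable {S T : TriSystem} {s : Finset (X × Y₁ × Y₂ × Y₃)} {α : X × Y₁ × Y₂ × Y₃ → S.A}
  {β : X × Y₁ × Y₂ × Y₃ → S.B} {ρ : X × Y₁ × Y₂ × Y₃ → S.R}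

theorem IsFamily.injective (h : IsFamily s α β ρ) :
    ∀ ω ∈ s, ∀ ω' ∈ s, α ω = α ω' → β ω = β ω' → ρ ω = ρ ω' → ω = ω' := by
  intro ω hω ω' hω' h1 h2 _
  have h1 := (h.A ω hω ω' hω').1 h1
  have h2 := (h.B ω hω ω' hω').1 h2
  exact Prod.ext h1.1 (Prod.ext h1.2.1 (Prod.ext h2.2.1 h2.2.2))

variable [Fintype X] [Fintype Y₁] [Fintype Y₂] [Fintype Y₃]
  [DecidableEq X] [DecidableEq Y₁] [DecidableEq Y₂] [DecidableEq Y₃]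

/-- The index set of `∑ x ∈ G, ∑ y₁ ∈ S₁ x, ∑ y₂ ∈ S₂ x, ∑ y₃ ∈ S₃ x`. -/
def familySet (G : Finset X) (S₁ : X → Finset Y₁) (S₂ : X → Finset Y₂) (S₃ : X → Finset Y₃) :
    Finset (X × Y₁ × Y₂ × Y₃) :=
  Finset.univ.filter fun ω => ω.1 ∈ G ∧ ω.2.1 ∈ S₁ ω.1 ∧ ω.2.2.1 ∈ S₂ ω.1 ∧ ω.2.2.2 ∈ S₃ ω.1

variable {G : Finset X} {S₁ : X → Finset Y₁} {S₂ : X → Finset Y₂} {S₃ : X → Finset Y₃}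

theorem mem_familySet {ω : X × Y₁ × Y₂ × Y₃} : ω ∈ familySet G S₁ S₂ S₃ ↔
    ω.1 ∈ G ∧ ω.2.1 ∈ S₁ ω.1 ∧ ω.2.2.1 ∈ S₂ ω.1 ∧ ω.2.2.2 ∈ S₃ ω.1 := by
  simp [familySet]

theorem familySet_univ : familySet (Finset.univ : Finset X) (fun _ => (Finset.univ : Finset Y₁))
    (fun _ => (Finset.univ : Finset Y₂)) (fun _ => (Finset.univ : Finset Y₃)) = Finset.univ := by
  ext ω
  simp [mem_familySet]

theorem sum_familySet {M : Type*} [CommSemiring M] (g : X → M) :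
    ∑ ω ∈ familySet G S₁ S₂ S₃, g ω.1 =
      ∑ x ∈ G, g x * ((S₁ x).card * (S₂ x).card * (S₃ x).card) := by
  have h : ∀ x, ∑ y₁ ∈ S₁ x, ∑ y₂ ∈ S₂ x, ∑ y₃ ∈ S₃ x, g x =
      g x * ((S₁ x).card * (S₂ x).card * (S₃ x).card) := by
    intro x
    simp only [Finset.sum_const, nsmul_eq_mul]
    ring
  simp only [← h, familySet, Finset.sum_filter, Fintype.sum_prod_type]
  rw [← Finset.sum_filter_add_sum_filter_not Finset.univ (· ∈ G)]
  rw [Finset.filter_mem_eq_inter, Finset.univ_inter, Finset.sum_eq_zero (s := Finset.univ.filter _),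
    add_zero]
  · refine Finset.sum_congr rfl fun x hx => ?_
    simp only [hx, true_and, ite_and, Finset.sum_ite_irrel, Finset.sum_const_zero]
    simp [Finset.sum_ite_mem]
  · intro x hx
    simp [(Finset.mem_filter.1 hx).2]

/-- In a family the coincidences among local labels are determined by coincidences of indices. A
bijection of the x, together with bijections of the yᵢ over each x, preserves these, so
`Reach.relabel` applies. -/
theorem Reach.transfer {X' Y₁' Y₂' Y₃' : Type} [Fintype X'] [Fintype Y₁'] [Fintype Y₂']
    [Fintype Y₃'] [DecidableEq X'] [DecidableEq Y₁'] [DecidableEq Y₂'] [DecidableEq Y₃']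
    {G' : Finset X'} {S₁' : X' → Finset Y₁'} {S₂' : X' → Finset Y₂'} {S₃' : X' → Finset Y₃'}
    {S' : TriSystem} {α' : X' × Y₁' × Y₂' × Y₃' → S'.A} {β' : X' × Y₁' × Y₂' × Y₃' → S'.B}
    {ρ' : X' × Y₁' × Y₂' × Y₃' → S'.R} {w : X → ℂ} {w' : X' → ℂ} {σ : T.Op}
    (hf : IsFamily (familySet G S₁ S₂ S₃) α β ρ)
    (hf' : IsFamily (familySet G' S₁' S₂' S₃') α' β' ρ')
    (hne : (familySet G S₁ S₂ S₃).Nonempty)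
    (e : X → X') (e₁ : X → Y₁ → Y₁') (e₂ : X → Y₂ → Y₂') (e₃ : X → Y₃ → Y₃')
    (he : Set.BijOn e G G') (he₁ : ∀ x ∈ G, Set.BijOn (e₁ x) (S₁ x) (S₁' (e x)))
    (he₂ : ∀ x ∈ G, Set.BijOn (e₂ x) (S₂ x) (S₂' (e x)))
    (he₃ : ∀ x ∈ G, Set.BijOn (e₃ x) (S₃ x) (S₃' (e x)))
    (hw : ∀ x ∈ G, w x = w' (e x))
    (h : Reach (labelled (familySet G' S₁' S₂' S₃') α' β' ρ' fun ω => w' ω.1) T σ) :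
    Reach (labelled (familySet G S₁ S₂ S₃) α β ρ fun ω => w ω.1) T σ := by
  let E : X × Y₁ × Y₂ × Y₃ → X' × Y₁' × Y₂' × Y₃' := fun ω =>
    (e ω.1, e₁ ω.1 ω.2.1, e₂ ω.1 ω.2.2.1, e₃ ω.1 ω.2.2.2)
  have hmem : ∀ ω ∈ familySet G S₁ S₂ S₃, E ω ∈ familySet G' S₁' S₂' S₃' := by
    intro ω hω
    rw [mem_familySet] at hω ⊢
    exact ⟨he.mapsTo hω.1, (he₁ _ hω.1).mapsTo hω.2.1, (he₂ _ hω.1).mapsTo hω.2.2.1,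
      (he₃ _ hω.1).mapsTo hω.2.2.2⟩
  have k0 : ∀ ω ∈ familySet G S₁ S₂ S₃, ∀ ω' ∈ familySet G S₁ S₂ S₃,
      (ω.1 = ω'.1 ↔ (E ω).1 = (E ω').1) := fun ω hω ω' hω' =>
    (he.injOn.eq_iff (mem_familySet.1 hω).1 (mem_familySet.1 hω').1).symm
  have k1 : ∀ ω ∈ familySet G S₁ S₂ S₃, ∀ ω' ∈ familySet G S₁ S₂ S₃, ω.1 = ω'.1 →
      (ω.2.1 = ω'.2.1 ↔ (E ω).2.1 = (E ω').2.1) := by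
    intro ω hω ω' hω' hx
    rw [mem_familySet] at hω hω'
    simp only [E, hx]
    exact ((he₁ _ hω'.1).injOn.eq_iff (hx ▸ hω.2.1) hω'.2.1).symm
  have k2 : ∀ ω ∈ familySet G S₁ S₂ S₃, ∀ ω' ∈ familySet G S₁ S₂ S₃, ω.1 = ω'.1 →
      (ω.2.2.1 = ω'.2.2.1 ↔ (E ω).2.2.1 = (E ω').2.2.1) := by
    intro ω hω ω' hω' hx
    rw [mem_familySet] at hω hω'
    simp only [E, hx]
    exact ((he₂ _ hω'.1).injOn.eq_iff (hx ▸ hω.2.2.1) hω'.2.2.1).symm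
  have k3 : ∀ ω ∈ familySet G S₁ S₂ S₃, ∀ ω' ∈ familySet G S₁ S₂ S₃, ω.1 = ω'.1 →
      (ω.2.2.2 = ω'.2.2.2 ↔ (E ω).2.2.2 = (E ω').2.2.2) := by
    intro ω hω ω' hω' hx
    rw [mem_familySet] at hω hω'
    simp only [E, hx]
    exact ((he₃ _ hω'.1).injOn.eq_iff (hx ▸ hω.2.2.2) hω'.2.2.2).symm
  have hE : Set.BijOn E (familySet G S₁ S₂ S₃) (familySet G' S₁' S₂' S₃') := by
    refine ⟨hmem, fun ω hω ω' hω' heq => ?_, ?_⟩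
    · have hx := (k0 ω hω ω' hω').2 (by rw [heq])
      exact Prod.ext hx (Prod.ext ((k1 ω hω ω' hω' hx).2 (by rw [heq]))
        (Prod.ext ((k2 ω hω ω' hω' hx).2 (by rw [heq])) ((k3 ω hω ω' hω' hx).2 (by rw [heq]))))
    · rintro ⟨x', y₁', y₂', y₃'⟩ h'
      obtain ⟨hx', h1', h2', h3'⟩ := mem_familySet.1 h'
      obtain ⟨x, hx, rfl⟩ := he.surjOn hx'
      obtain ⟨y₁, h1, rfl⟩ := (he₁ x hx).surjOn h1'
      obtain ⟨y₂, h2, rfl⟩ := (he₂ x hx).surjOn h2'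
      obtain ⟨y₃, h3, rfl⟩ := (he₃ x hx).surjOn h3'
      exact ⟨(x, y₁, y₂, y₃), mem_familySet.2 ⟨hx, h1, h2, h3⟩, rfl⟩
  rw [labelled_reindex E hE] at h
  rw [labelled_congr (w' := fun ω => w' (E ω).1) (fun _ _ => rfl) (fun _ _ => rfl) (fun _ _ => rfl)
    (fun ω hω => hw _ (mem_familySet.1 hω).1)]
  refine Reach.relabel hne (fun ω hω ω' hω' => ?_) (fun ω hω ω' hω' => ?_)
    (fun ω hω ω' hω' => ?_) h
  · rw [hf.A ω hω ω' hω', hf'.A _ (hmem ω hω) _ (hmem ω' hω'), ← k0 ω hω ω' hω']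
    exact and_congr_right fun hx =>
      and_congr (k1 ω hω ω' hω' hx) (k3 ω hω ω' hω' hx)
  · rw [hf.B ω hω ω' hω', hf'.B _ (hmem ω hω) _ (hmem ω' hω'), ← k0 ω hω ω' hω']
    exact and_congr_right fun hx =>
      and_congr (k2 ω hω ω' hω' hx) (k3 ω hω ω' hω' hx)
  · rw [hf.R ω hω ω' hω', hf'.R _ (hmem ω hω) _ (hmem ω' hω'), ← k0 ω hω ω' hω']
    exact and_congr_right fun hx =>
      and_congr (k1 ω hω ω' hω' hx) (k2 ω hω ω' hω' hx)

variable (X Y₁ Y₂ Y₃) in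
/-- The system whose local labels are `(x, y₁, y₃)`, `(x, y₂, y₃)` and `(x, y₁, y₂)`. -/
abbrev stdSystem : TriSystem where
  A := X × Y₁ × Y₃
  B := X × Y₂ × Y₃
  R := X × Y₁ × Y₂

/-- The vector `∑ w(x, y₁, y₂, y₃) |x y₁ y₃⟩|x y₂ y₃⟩|x y₁ y₂⟩`. -/
def stdVec (s : Finset (X × Y₁ × Y₂ × Y₃)) (w : X × Y₁ × Y₂ × Y₃ → ℂ) :
    (stdSystem X Y₁ Y₂ Y₃).Idx → ℂ :=
  labelled (S := stdSystem X Y₁ Y₂ Y₃) s (fun ω => (ω.1, ω.2.1, ω.2.2.2))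
    (fun ω => (ω.1, ω.2.2.1, ω.2.2.2)) (fun ω => (ω.1, ω.2.1, ω.2.2.1)) w

theorem isFamily_std (s : Finset (X × Y₁ × Y₂ × Y₃)) :
    IsFamily (S := stdSystem X Y₁ Y₂ Y₃) s (fun ω => (ω.1, ω.2.1, ω.2.2.2))
    (fun ω => (ω.1, ω.2.2.1, ω.2.2.2)) (fun ω => (ω.1, ω.2.1, ω.2.2.1)) := by
  constructor <;> intro ω _ ω' _ <;> simp [Prod.ext_iff]

/-- Four shift rounds, one per register. The amplitude must still be invariant under the
translations of each round, so x comes first: the `bᵢ` depend on x, whereas translating a y leaves x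
alone. B performs the round for y₂, which A does not hold. -/
theorem Reach.std_dilute [AddGroup X] [AddGroup Y₁] [AddGroup Y₂] [AddGroup Y₃] {σ : T.Op}
    (κ : ℂ) (a : X → ℂ) (b₁ : X → Y₁ → ℂ) (b₂ : X → Y₂ → ℂ) (b₃ : X → Y₃ → ℂ)
    (ha : ∑ x, star (a x) * a x = 1) (hb₁ : ∀ x, ∑ y, star (b₁ x y) * b₁ x y = 1)
    (hb₂ : ∀ x, ∑ y, star (b₂ x y) * b₂ x y = 1) (hb₃ : ∀ x, ∑ y, star (b₃ x y) * b₃ x y = 1)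
    (h : Reach (stdVec Finset.univ fun ω : X × Y₁ × Y₂ × Y₃ =>
      b₂ ω.1 ω.2.2.1 * (b₃ ω.1 ω.2.2.2 * (b₁ ω.1 ω.2.1 * (a ω.1 * κ)))) T σ) :
    Reach (stdVec Finset.univ fun _ : X × Y₁ × Y₂ × Y₃ => κ) T
      (((Fintype.card X * Fintype.card Y₁ * Fintype.card Y₂ * Fintype.card Y₃ : ℕ) : ℂ) • σ) := by
  have e : (((Fintype.card X * Fintype.card Y₁ * Fintype.card Y₂ * Fintype.card Y₃ : ℕ) : ℂ) • σ) =
      (Fintype.card X : ℂ) • (Fintype.card Y₁ : ℂ) • (Fintype.card Y₃ : ℂ) •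
        (Fintype.card Y₂ : ℂ) • σ := by
    simp only [smul_smul]
    push_cast
    congr 1
    ring
  rw [e]
  refine Reach.shiftA (J := X) (fun j => (Equiv.addLeft j).prodCongr (Equiv.refl _))
    (fun j q => (j + q.1, q.2)) (fun j q q' => ?_) (fun q => a q.1) (fun q => ?_)
    (fun _ _ => rfl) (fun j ω ω' => ?_) (fun j ω ω' => ?_) (fun _ _ => rfl) ?_
  · simp [Prod.ext_iff]
  · rw [← ha]
    exact Equiv.sum_comp (Equiv.addRight q.1) fun x => star (a x) * a x
  · simp [Prod.ext_iff]
  · simp [Prod.ext_iff]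
  refine Reach.shiftA (J := Y₁)
    (fun j => (Equiv.refl _).prodCongr ((Equiv.addLeft j).prodCongr (Equiv.refl _)))
    (fun j q => (q.1, j + q.2.1, q.2.2)) (fun j q q' => ?_) (fun q => b₁ q.1 q.2.1) (fun q => ?_)
    (fun _ _ => rfl) (fun j ω ω' => ?_) (fun j ω ω' => ?_) (fun _ _ => rfl) ?_
  · simp [Prod.ext_iff]
  · rw [← hb₁ q.1]
    exact Equiv.sum_comp (Equiv.addRight q.2.1) fun x => star (b₁ q.1 x) * b₁ q.1 x
  · simp [Prod.ext_iff]
  · simp [Prod.ext_iff]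
  refine Reach.shiftA (J := Y₃)
    (fun j => (Equiv.refl _).prodCongr ((Equiv.refl _).prodCongr
      ((Equiv.refl _).prodCongr (Equiv.addLeft j))))
    (fun j q => (q.1, q.2.1, j + q.2.2)) (fun j q q' => ?_) (fun q => b₃ q.1 q.2.2) (fun q => ?_)
    (fun _ _ => rfl) (fun j ω ω' => ?_) (fun j ω ω' => ?_) (fun _ _ => rfl) ?_
  · simp [Prod.ext_iff]
  · rw [← hb₃ q.1]
    exact Equiv.sum_comp (Equiv.addRight q.2.2) fun x => star (b₃ q.1 x) * b₃ q.1 x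
  · simp [Prod.ext_iff]
  · simp [Prod.ext_iff]
  refine Reach.shiftB (J := Y₂)
    (fun j => (Equiv.refl _).prodCongr ((Equiv.refl _).prodCongr
      ((Equiv.addLeft j).prodCongr (Equiv.refl _))))
    (fun j q => (q.1, j + q.2.1, q.2.2)) (fun j q q' => ?_) (fun q => b₂ q.1 q.2.1) (fun q => ?_)
    (fun _ _ => rfl) (fun j ω ω' => ?_) (fun j ω ω' => ?_) (fun _ _ => rfl) h
  · simp [Prod.ext_iff]
  · rw [← hb₂ q.1]
    exact Equiv.sum_comp (Equiv.addRight q.2.1) fun x => star (b₂ q.1 x) * b₂ q.1 x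
  · simp [Prod.ext_iff]
  · simp [Prod.ext_iff]

theorem exists_bijOn_univ {A B : Type} [Fintype B] [Nonempty B] {s : Finset A}
    (h : s.card = Fintype.card B) :
    ∃ e : A → B, Set.BijOn e s (Finset.univ : Finset B) := by
  have φ : s ≃ B := Fintype.equivOfCardEq (by simpa using h)
  have he : ∀ a : s, Function.extend Subtype.val φ (fun _ => Classical.arbitrary B) a.1 = φ a :=
    fun a => Subtype.val_injective.extend_apply _ _ a
  refine ⟨Function.extend Subtype.val φ fun _ => Classical.arbitrary B, by simp,
    fun a ha a' ha' h => ?_, fun b _ => ⟨(φ.symm b).1, (φ.symm b).2, by rw [he]; simp⟩⟩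
  rw [he ⟨a, ha⟩, he ⟨a', ha'⟩] at h
  exact congrArg Subtype.val (φ.injective h)

/-- The map takes values in s even outside D; this keeps the conditional amplitudes in
`Reach.std_family` normalised at every x, including those of amplitude 0. -/
theorem exists_bijOn_of_card_le {A B : Type} [Fintype B] [DecidableEq B] {s : Finset A}
    (hs : s.Nonempty) (h : s.card ≤ Fintype.card B) :
    ∃ (f : B → A) (D : Finset B), Set.BijOn f D s ∧ ∀ b, f b ∈ s := by
  obtain ⟨φ⟩ : Nonempty (s ↪ B) := Function.Embedding.nonempty_of_card_le (by simpa using h)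
  have : Nonempty s := hs.to_subtype
  have hl := Function.leftInverse_invFun φ.injective
  refine ⟨fun b => (Function.invFun φ b).1, Finset.univ.map φ, ⟨fun b _ => Subtype.prop _, ?_, ?_⟩,
    fun b => Subtype.prop _⟩
  · intro b hb b' hb' heq
    simp only [Finset.coe_map, Finset.coe_univ, Set.image_univ, Set.mem_range] at hb hb'
    obtain ⟨a, rfl⟩ := hb
    obtain ⟨a', rfl⟩ := hb'
    have := Subtype.ext heq
    rw [hl a, hl a'] at this
    rw [this]
  · intro a ha
    exact ⟨φ ⟨a, ha⟩, by simp, by simp [hl _]⟩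

end Family

theorem sum_uniform {B : Type} [Fintype B] [DecidableEq B] {D : Finset B} (hD : 0 < D.card) :
    ∑ y, star (if y ∈ D then ((√(D.card : ℝ))⁻¹ : ℂ) else 0) *
      (if y ∈ D then ((√(D.card : ℝ))⁻¹ : ℂ) else 0) = 1 := by
  have h : (star ((√(D.card : ℝ))⁻¹ : ℂ)) * ((√(D.card : ℝ))⁻¹ : ℂ) = (D.card : ℂ)⁻¹ := by
    rw [← Complex.ofReal_inv, Complex.star_def, Complex.conj_ofReal, ← Complex.ofReal_mul, ← mul_inv,
      Real.mul_self_sqrt (Nat.cast_nonneg _)]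
    push_cast; rfl
  simp only [apply_ite star, star_zero, ite_mul, zero_mul, mul_ite, mul_zero, h]
  have hD' : (D.card : ℂ) ≠ 0 := by exact_mod_cast hD.ne'
  simp [← ite_and, hD']

/-! ### Exact conversion of families with constant amplitude -/

section Dilution

variable {X Y₁ Y₂ Y₃ : Type} [Fintype X] [Fintype Y₁] [Fintype Y₂] [Fintype Y₃]
  [DecidableEq X] [DecidableEq Y₁] [DecidableEq Y₂] [DecidableEq Y₃]
  {G : Finset X} {S₁ : X → Finset Y₁} {S₂ : X → Finset Y₂} {S₃ : X → Finset Y₃}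
  {X' Y₁' Y₂' Y₃' : Type} [Fintype X'] [Fintype Y₁'] [Fintype Y₂']
  [Fintype Y₃'] [DecidableEq X'] [DecidableEq Y₁'] [DecidableEq Y₂'] [DecidableEq Y₃']
  {G' : Finset X'} {S₁' : X' → Finset Y₁'} {S₂' : X' → Finset Y₂'} {S₃' : X' → Finset Y₃'}

theorem familySet_nonempty (hG : G.Nonempty) (h₁ : ∀ x ∈ G, 0 < (S₁ x).card)
    (h₂ : ∀ x ∈ G, 0 < (S₂ x).card) (h₃ : ∀ x ∈ G, 0 < (S₃ x).card) :
    (familySet G S₁ S₂ S₃).Nonempty := by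
  obtain ⟨x, hx⟩ := hG
  obtain ⟨y₁, k₁⟩ := Finset.card_pos.1 (h₁ x hx)
  obtain ⟨y₂, k₂⟩ := Finset.card_pos.1 (h₂ x hx)
  obtain ⟨y₃, k₃⟩ := Finset.card_pos.1 (h₃ x hx)
  exact ⟨(x, y₁, y₂, y₃), mem_familySet.2 ⟨hx, k₁, k₂, k₃⟩⟩

/-- From a maximally entangled family on groups to any normalised family with smaller index
sets. -/
theorem Reach.std_family [AddGroup X] [AddGroup Y₁] [AddGroup Y₂] [AddGroup Y₃]
    {S' T : TriSystem} {α' : X' × Y₁' × Y₂' × Y₃' → S'.A} {β' : X' × Y₁' × Y₂' × Y₃' → S'.B}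
    {ρ' : X' × Y₁' × Y₂' × Y₃' → S'.R} {a' : X' → ℂ} (κ : ℂ)
    (hf' : IsFamily (familySet G' S₁' S₂' S₃') α' β' ρ')
    (hG' : G'.Nonempty) (hc : G'.card ≤ Fintype.card X)
    (h₁ : ∀ x ∈ G', 0 < (S₁' x).card) (hc₁ : ∀ x ∈ G', (S₁' x).card ≤ Fintype.card Y₁)
    (h₂ : ∀ x ∈ G', 0 < (S₂' x).card) (hc₂ : ∀ x ∈ G', (S₂' x).card ≤ Fintype.card Y₂)
    (h₃ : ∀ x ∈ G', 0 < (S₃' x).card) (hc₃ : ∀ x ∈ G', (S₃' x).card ≤ Fintype.card Y₃)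
    (ha' : ∑ x ∈ G', star (a' x) * a' x * ((S₁' x).card * (S₂' x).card * (S₃' x).card) = 1)
    {σ : T.Op}
    (h : Reach (labelled (familySet G' S₁' S₂' S₃') α' β' ρ' fun ω => a' ω.1) T σ) :
    Reach (stdVec Finset.univ fun _ : X × Y₁ × Y₂ × Y₃ => κ) T
      ((κ * star κ * (Fintype.card X * Fintype.card Y₁ * Fintype.card Y₂ * Fintype.card Y₃ : ℕ)) •
        σ) := by
  classical
  obtain ⟨e, D, he, heG⟩ := exists_bijOn_of_card_le hG' hc
  have E₁ : ∀ x, ∃ (f : Y₁ → Y₁') (D : Finset Y₁), x ∈ G' → Set.BijOn f D (S₁' x) := by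
    intro x
    by_cases hx : x ∈ G'
    · obtain ⟨f, D, hf, _⟩ := exists_bijOn_of_card_le (Finset.card_pos.1 (h₁ x hx)) (hc₁ x hx)
      exact ⟨f, D, fun _ => hf⟩
    · exact ⟨fun _ => (Finset.card_pos.1 (h₁ _ hG'.choose_spec)).choose, ∅, fun h => absurd h hx⟩
  have E₂ : ∀ x, ∃ (f : Y₂ → Y₂') (D : Finset Y₂), x ∈ G' → Set.BijOn f D (S₂' x) := by
    intro x
    by_cases hx : x ∈ G'
    · obtain ⟨f, D, hf, _⟩ := exists_bijOn_of_card_le (Finset.card_pos.1 (h₂ x hx)) (hc₂ x hx)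
      exact ⟨f, D, fun _ => hf⟩
    · exact ⟨fun _ => (Finset.card_pos.1 (h₂ _ hG'.choose_spec)).choose, ∅, fun h => absurd h hx⟩
  have E₃ : ∀ x, ∃ (f : Y₃ → Y₃') (D : Finset Y₃), x ∈ G' → Set.BijOn f D (S₃' x) := by
    intro x
    by_cases hx : x ∈ G'
    · obtain ⟨f, D, hf, _⟩ := exists_bijOn_of_card_le (Finset.card_pos.1 (h₃ x hx)) (hc₃ x hx)
      exact ⟨f, D, fun _ => hf⟩
    · exact ⟨fun _ => (Finset.card_pos.1 (h₃ _ hG'.choose_spec)).choose, ∅, fun h => absurd h hx⟩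
  choose f₁ D₁ hD₁ using E₁
  choose f₂ D₂ hD₂ using E₂
  choose f₃ D₃ hD₃ using E₃
  have cD₁ : ∀ x ∈ G', (D₁ x).card = (S₁' x).card := fun x hx => (hD₁ x hx).finsetCard_eq
  have cD₂ : ∀ x ∈ G', (D₂ x).card = (S₂' x).card := fun x hx => (hD₂ x hx).finsetCard_eq
  have cD₃ : ∀ x ∈ G', (D₃ x).card = (S₃' x).card := fun x hx => (hD₃ x hx).finsetCard_eq
  -- The uniform amplitudes on the `Dᵢ` contribute |Dᵢ|^{-1/2} each. The amplitude of x carries the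
  -- inverse factor r, so that the product is a' and normalisation is exactly `ha'`.
  let r : X' → ℂ := fun x => √((D₁ x).card : ℝ) * √((D₂ x).card : ℝ) * √((D₃ x).card : ℝ)
  have hr : ∀ x, star (r x) * r x = (D₁ x).card * (D₂ x).card * (D₃ x).card := by
    intro x
    have h : ∀ n : ℕ, ((√(n : ℝ) : ℝ) : ℂ) * ((√(n : ℝ) : ℝ) : ℂ) = n := by
      intro n
      rw [← Complex.ofReal_mul, Real.mul_self_sqrt (Nat.cast_nonneg _), Complex.ofReal_natCast]
    simp only [r, star_mul', Complex.star_def, Complex.conj_ofReal]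
    linear_combination (√((D₂ x).card : ℝ) * √((D₂ x).card : ℝ) * (√((D₃ x).card : ℝ) *
      √((D₃ x).card : ℝ)) : ℂ) * h (D₁ x).card + (D₁ x).card * (√((D₃ x).card : ℝ) *
      √((D₃ x).card : ℝ) : ℂ) * h (D₂ x).card + (D₁ x).card * (D₂ x).card * h (D₃ x).card
  have key := Reach.std_dilute (T := T) (X := X) (Y₁ := Y₁) (Y₂ := Y₂) (Y₃ := Y₃)
    (σ := (κ * star κ) • σ) κ
    (fun x => if x ∈ D then a' (e x) * r (e x) else 0)
    (fun x y => if y ∈ D₁ (e x) then ((√((D₁ (e x)).card : ℝ))⁻¹ : ℂ) else 0)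
    (fun x y => if y ∈ D₂ (e x) then ((√((D₂ (e x)).card : ℝ))⁻¹ : ℂ) else 0)
    (fun x y => if y ∈ D₃ (e x) then ((√((D₃ (e x)).card : ℝ))⁻¹ : ℂ) else 0)
    ?_ (fun x => sum_uniform (by rw [cD₁ _ (heG x)]; exact h₁ _ (heG x)))
    (fun x => sum_uniform (by rw [cD₂ _ (heG x)]; exact h₂ _ (heG x)))
    (fun x => sum_uniform (by rw [cD₃ _ (heG x)]; exact h₃ _ (heG x))) ?_
  · rw [smul_smul] at key
    convert key using 2
    ring
  · rw [← ha']
    have : ∀ x, star (if x ∈ D then a' (e x) * r (e x) else 0) *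
        (if x ∈ D then a' (e x) * r (e x) else 0) =
        if x ∈ D then star (a' (e x)) * a' (e x) * (star (r (e x)) * r (e x)) else 0 := by
      intro x
      split_ifs
      · simp only [star_mul']
        ring
      · simp
    simp only [this, Finset.sum_ite_mem, Finset.univ_inter]
    refine Finset.sum_nbij e (fun x hx => he.mapsTo hx) he.injOn he.surjOn fun x hx => ?_
    rw [hr, cD₁ _ (heG x), cD₂ _ (heG x), cD₃ _ (heG x)]
  · have hne : (familySet D (fun x => D₁ (e x)) (fun x => D₂ (e x))
        (fun x => D₃ (e x))).Nonempty := by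
      refine familySet_nonempty ?_ (fun x _ => by rw [cD₁ _ (heG x)]; exact h₁ _ (heG x))
        (fun x _ => by rw [cD₂ _ (heG x)]; exact h₂ _ (heG x))
        (fun x _ => by rw [cD₃ _ (heG x)]; exact h₃ _ (heG x))
      rw [← Finset.card_pos, he.finsetCard_eq]
      exact hG'.card_pos
    have h2 := (Reach.transfer (w := fun x => a' (e x)) (isFamily_std _) hf' hne e (fun x => f₁ (e x))
      (fun x => f₂ (e x)) (fun x => f₃ (e x)) he (fun x _ => hD₁ _ (heG x))
      (fun x _ => hD₂ _ (heG x)) (fun x _ => hD₃ _ (heG x)) (fun _ _ => rfl) h).smul κ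
    convert h2 using 1
    rw [← labelled_smul, familySet, labelled_filter]
    refine labelled_congr (fun _ _ => rfl) (fun _ _ => rfl) (fun _ _ => rfl) fun ω _ => ?_
    have q₁ : (√((D₁ (e ω.1)).card : ℝ) : ℂ) ≠ 0 := by
      have := h₁ _ (heG ω.1)
      rw [← cD₁ _ (heG ω.1)] at this
      exact_mod_cast (Real.sqrt_pos.2 (Nat.cast_pos.2 this)).ne'
    have q₂ : (√((D₂ (e ω.1)).card : ℝ) : ℂ) ≠ 0 := by
      have := h₂ _ (heG ω.1)
      rw [← cD₂ _ (heG ω.1)] at this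
      exact_mod_cast (Real.sqrt_pos.2 (Nat.cast_pos.2 this)).ne'
    have q₃ : (√((D₃ (e ω.1)).card : ℝ) : ℂ) ≠ 0 := by
      have := h₃ _ (heG ω.1)
      rw [← cD₃ _ (heG ω.1)] at this
      exact_mod_cast (Real.sqrt_pos.2 (Nat.cast_pos.2 this)).ne'
    by_cases m0 : ω.1 ∈ D <;> by_cases m1 : ω.2.1 ∈ D₁ (e ω.1) <;>
      by_cases m2 : ω.2.2.1 ∈ D₂ (e ω.1) <;> by_cases m3 : ω.2.2.2 ∈ D₃ (e ω.1) <;>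
      simp [m0, m1, m2, m3]
    simp only [r]
    field_simp

/-- The source is first relabelled by the cyclic groups `Fin n`, `Fin s₁`, `Fin s₂`, `Fin s₃`, which
is possible because the fibre sizes do not depend on x. The scalar in front of the output is the
squared norm of the input. -/
theorem Reach.family {S S' : TriSystem} {α : X × Y₁ × Y₂ × Y₃ → S.A}
    {β : X × Y₁ × Y₂ × Y₃ → S.B} {ρ : X × Y₁ × Y₂ × Y₃ → S.R} (κ : ℂ)
    {α' : X' × Y₁' × Y₂' × Y₃' → S'.A} {β' : X' × Y₁' × Y₂' × Y₃' → S'.B}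
    {ρ' : X' × Y₁' × Y₂' × Y₃' → S'.R} {a' : X' → ℂ}
    (hf : IsFamily (familySet G S₁ S₂ S₃) α β ρ)
    (hf' : IsFamily (familySet G' S₁' S₂' S₃') α' β' ρ') {n s₁ s₂ s₃ : ℕ}
    (hG : G.card = n) (hS₁ : ∀ x ∈ G, (S₁ x).card = s₁) (hS₂ : ∀ x ∈ G, (S₂ x).card = s₂)
    (hS₃ : ∀ x ∈ G, (S₃ x).card = s₃)
    (hG' : G'.Nonempty) (hc : G'.card ≤ n)
    (h₁ : ∀ x ∈ G', 0 < (S₁' x).card) (hc₁ : ∀ x ∈ G', (S₁' x).card ≤ s₁)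
    (h₂ : ∀ x ∈ G', 0 < (S₂' x).card) (hc₂ : ∀ x ∈ G', (S₂' x).card ≤ s₂)
    (h₃ : ∀ x ∈ G', 0 < (S₃' x).card) (hc₃ : ∀ x ∈ G', (S₃' x).card ≤ s₃)
    (ha' : ∑ x ∈ G', star (a' x) * a' x * ((S₁' x).card * (S₂' x).card * (S₃' x).card) = 1) :
    Reach (labelled (familySet G S₁ S₂ S₃) α β ρ fun _ => κ) S'
      ((κ * star κ * (n * s₁ * s₂ * s₃ : ℕ)) •
        outer (labelled (familySet G' S₁' S₂' S₃') α' β' ρ' fun ω => a' ω.1)) := by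
  classical
  obtain ⟨x', hx'⟩ := hG'
  -- The group structure on `Fin` needs nonzero sizes, which the nonempty target index sets force.
  have : NeZero n := ⟨((Finset.card_pos.2 ⟨x', hx'⟩).trans_le hc).ne'⟩
  have : NeZero s₁ := ⟨((h₁ x' hx').trans_le (hc₁ x' hx')).ne'⟩
  have : NeZero s₂ := ⟨((h₂ x' hx').trans_le (hc₂ x' hx')).ne'⟩
  have : NeZero s₃ := ⟨((h₃ x' hx').trans_le (hc₃ x' hx')).ne'⟩
  obtain ⟨e, he⟩ := exists_bijOn_univ (B := Fin n) (s := G) (by simpa using hG)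
  have E₁ : ∀ x, ∃ f : Y₁ → Fin s₁, x ∈ G → Set.BijOn f (S₁ x) (Finset.univ : Finset (Fin s₁)) := by
    intro x
    by_cases hx : x ∈ G
    · exact (exists_bijOn_univ (by simpa using hS₁ x hx)).imp fun _ h _ => h
    · exact ⟨fun _ => 0, fun h => absurd h hx⟩
  have E₂ : ∀ x, ∃ f : Y₂ → Fin s₂, x ∈ G → Set.BijOn f (S₂ x) (Finset.univ : Finset (Fin s₂)) := by
    intro x
    by_cases hx : x ∈ G
    · exact (exists_bijOn_univ (by simpa using hS₂ x hx)).imp fun _ h _ => h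
    · exact ⟨fun _ => 0, fun h => absurd h hx⟩
  have E₃ : ∀ x, ∃ f : Y₃ → Fin s₃, x ∈ G → Set.BijOn f (S₃ x) (Finset.univ : Finset (Fin s₃)) := by
    intro x
    by_cases hx : x ∈ G
    · exact (exists_bijOn_univ (by simpa using hS₃ x hx)).imp fun _ h _ => h
    · exact ⟨fun _ => 0, fun h => absurd h hx⟩
  choose f₁ hf₁ using E₁
  choose f₂ hf₂ using E₂
  choose f₃ hf₃ using E₃
  have h := Reach.std_family (X := Fin n) (Y₁ := Fin s₁) (Y₂ := Fin s₂) (Y₃ := Fin s₃) κ hf'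
    ⟨x', hx'⟩ (by simpa using hc) h₁ (by simpa using hc₁) h₂ (by simpa using hc₂) h₃
    (by simpa using hc₃) ha' (Reach.done _)
  simp only [Fintype.card_fin] at h
  rw [← familySet_univ] at h
  refine Reach.transfer (w := fun _ => κ) (w' := fun _ => κ) hf (isFamily_std _) ?_ e f₁ f₂ f₃ he
    hf₁ hf₂ hf₃ (fun _ _ => rfl) h
  refine familySet_nonempty (Finset.card_pos.1 (hG ▸ Nat.pos_of_neZero n)) (fun x hx => ?_)
    (fun x hx => ?_) (fun x hx => ?_)
  · rw [hS₁ x hx]; exact Nat.pos_of_neZero _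
  · rw [hS₂ x hx]; exact Nat.pos_of_neZero _
  · rw [hS₃ x hx]; exact Nat.pos_of_neZero _

end Dilution

/-! ### Trace norm estimates -/

section TraceNorm

variable {ι : Type*}

theorem conjTranspose_outer (u : ι → ℂ) : (outer u)ᴴ = outer u := by
  ext i j
  simp [outer, Matrix.vecMulVec_apply, mul_comm]

variable [Fintype ι]

theorem trace_outer_mul_outer (u v : ι → ℂ) :
    (outer u * outer v).trace = (star u ⬝ᵥ v) * star (star u ⬝ᵥ v) := by
  rw [outer, outer, Matrix.vecMulVec_mul_vecMulVec, Matrix.trace_vecMulVec, Matrix.star_dotProduct,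
    star_star, dotProduct_smul, smul_eq_mul, dotProduct_comm u]

theorem rank_smul_outer_sub_le (c : ℂ) (u v : ι → ℂ) :
    (c • (outer u - outer v)).rank ≤ 2 := by
  have h : c • (outer u - outer v) =
      (Matrix.of fun i => ![c * u i, -(c * v i)]) * Matrix.of ![star u, star v] := by
    ext i j
    simp [outer, Matrix.vecMulVec_apply, Matrix.mul_apply]
    ring
  rw [h]
  exact (Matrix.rank_mul_le_left _ _).trans ((Matrix.rank_le_card_width _).trans (by simp))

variable [DecidableEq ι]

open scoped ComplexOrder in
-- Cauchy–Schwarz applied to the nonzero singular values, whose number is the rank.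
theorem traceNorm_le_sqrt_rank_mul (M : Matrix ι ι ℂ) :
    traceNorm M ≤ √(M.rank) * √((Mᴴ * M).trace.re) := by
  set hM := Matrix.isHermitian_conjTranspose_mul_self M
  have hnn : ∀ i, 0 ≤ hM.eigenvalues i :=
    (Matrix.posSemidef_conjTranspose_mul_self M).eigenvalues_nonneg
  have htr : (Mᴴ * M).trace.re = ∑ i, hM.eigenvalues i := by
    rw [hM.trace_eq_sum_eigenvalues]
    simp
  have hrk : M.rank = (Finset.univ.filter fun i => hM.eigenvalues i ≠ 0).card := by
    rw [← Matrix.rank_conjTranspose_mul_self, hM.rank_eq_card_non_zero_eigs, Fintype.card_subtype]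
  have hsum : traceNorm M =
      ∑ i ∈ Finset.univ.filter (fun i => hM.eigenvalues i ≠ 0), √(hM.eigenvalues i) := by
    rw [Finset.sum_filter_of_ne]
    · rfl
    · intro i _ h h0
      exact h (by rw [h0, Real.sqrt_zero])
  rw [← Real.sqrt_mul (Nat.cast_nonneg _)]
  refine Real.le_sqrt_of_sq_le ?_
  rw [hsum, hrk, htr]
  refine sq_sum_le_card_mul_sum_sq.trans (mul_le_mul_of_nonneg_left ?_ (Nat.cast_nonneg _))
  simp only [Real.sq_sqrt (hnn _)]
  exact Finset.sum_le_sum_of_subset_of_nonneg (Finset.filter_subset _ _) fun i _ _ => hnn i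

/-- The difference of the two projections has rank at most 2 and squared Hilbert–Schmidt norm 2(1 -
|⟨u, v⟩|²). -/
theorem traceNorm_smul_outer_sub_le (c : ℂ) {u v : ι → ℂ} (hu : star u ⬝ᵥ u = 1)
    (hv : star v ⬝ᵥ v = 1) :
    traceNorm (c • (outer u - outer v)) ≤ 2 * ‖c‖ * √(1 - ‖star u ⬝ᵥ v‖ ^ 2) := by
  have hz : ∀ z : ℂ, z * star z = ((‖z‖ ^ 2 : ℝ) : ℂ) := by
    intro z
    rw [Complex.star_def, Complex.mul_conj, Complex.normSq_eq_norm_sq]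
  have hvu : (star v ⬝ᵥ u) = star (star u ⬝ᵥ v) := by
    rw [Matrix.star_dotProduct]
  have htr : (((c • (outer u - outer v))ᴴ * (c • (outer u - outer v))).trace).re =
      ‖c‖ ^ 2 * (2 * (1 - ‖star u ⬝ᵥ v‖ ^ 2)) := by
    have : ((c • (outer u - outer v))ᴴ * (c • (outer u - outer v))).trace =
        ((‖c‖ ^ 2 * (2 * (1 - ‖star u ⬝ᵥ v‖ ^ 2)) : ℝ) : ℂ) := by
      rw [Matrix.conjTranspose_smul, Matrix.conjTranspose_sub, conjTranspose_outer,
        conjTranspose_outer, Matrix.smul_mul, Matrix.mul_smul, Matrix.trace_smul, Matrix.trace_smul,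
        Matrix.sub_mul, Matrix.mul_sub, Matrix.mul_sub, Matrix.trace_sub, Matrix.trace_sub,
        Matrix.trace_sub, trace_outer_mul_outer, trace_outer_mul_outer, trace_outer_mul_outer,
        trace_outer_mul_outer, hu, hv, hvu, star_star, mul_comm (star (star u ⬝ᵥ v)), hz, hz,
        smul_smul, mul_comm (star c), hz, smul_eq_mul, norm_one]
      push_cast
      ring
    rw [this, Complex.ofReal_re]
  have hr : √((c • (outer u - outer v)).rank : ℝ) ≤ √2 :=
    Real.sqrt_le_sqrt (by exact_mod_cast rank_smul_outer_sub_le c u v)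
  refine (traceNorm_le_sqrt_rank_mul _).trans
    ((mul_le_mul_of_nonneg_right hr (Real.sqrt_nonneg _)).trans_eq ?_)
  rw [htr, Real.sqrt_mul (by positivity), Real.sqrt_sq (norm_nonneg _),
    Real.sqrt_mul (by norm_num : (0 : ℝ) ≤ 2)]
  linear_combination ‖c‖ * √(1 - ‖star u ⬝ᵥ v‖ ^ 2) * Real.mul_self_sqrt (by norm_num : (0:ℝ) ≤ 2)

end TraceNorm

/-! ### EPR pairs and GHZ states as a family -/

section Targets

/-- `EPR_AR^{⊗ m₁} ⊗ EPR_BR^{⊗ m₂} ⊗ EPR_AB^{⊗ m₃} ⊗ GHZ_ABR^{⊗ m₄}`. -/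
abbrev eprGhzPow (m₁ m₂ m₃ m₄ : ℕ) : TriVector :=
  (((eprAR.pow m₁).tensor (eprBR.pow m₂)).tensor (eprAB.pow m₃)).tensor (ghzABR.pow m₄)

variable {m₁ m₂ m₃ m₄ : ℕ}

/-- Labels of the system of `eprGhzPow`: the bits `x` of the GHZ states and the bits
`y₁, y₂, y₃` of the EPR pairs. -/
abbrev EprGhzIdx (m₁ m₂ m₃ m₄ : ℕ) : Type :=
  (Fin m₄ → Fin 2) × (Fin m₁ → Fin 2) × (Fin m₂ → Fin 2) × (Fin m₃ → Fin 2)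

def eprGhzA (ω : EprGhzIdx m₁ m₂ m₃ m₄) : (eprGhzPow m₁ m₂ m₃ m₄).sys.A :=
  (((ω.2.1, fun _ => ()), ω.2.2.2), ω.1)

def eprGhzB (ω : EprGhzIdx m₁ m₂ m₃ m₄) : (eprGhzPow m₁ m₂ m₃ m₄).sys.B :=
  (((fun _ => (), ω.2.2.1), ω.2.2.2), ω.1)

def eprGhzR (ω : EprGhzIdx m₁ m₂ m₃ m₄) : (eprGhzPow m₁ m₂ m₃ m₄).sys.R :=
  (((ω.2.1, ω.2.2.1), fun _ => ()), ω.1)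

theorem isFamily_eprGhz (s : Finset (EprGhzIdx m₁ m₂ m₃ m₄)) :
    IsFamily s eprGhzA eprGhzB eprGhzR := by
  constructor <;> rintro ⟨x, y₁, y₂, y₃⟩ _ ⟨x', y₁', y₂', y₃'⟩ _ <;>
    simp only [eprGhzA, eprGhzB, eprGhzR, Prod.mk.injEq] <;> tauto

theorem eprGhzPow_vec : (eprGhzPow m₁ m₂ m₃ m₄).vec =
    labelled Finset.univ eprGhzA eprGhzB eprGhzR
      fun _ => (((1 / √2 : ℝ) ^ (m₁ + m₂ + m₃ + m₄) : ℝ) : ℂ) := by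
  funext ⟨⟨⟨⟨a₁, a₂⟩, a₃⟩, a₄⟩, ⟨⟨⟨b₁, b₂⟩, b₃⟩, b₄⟩, ⟨⟨⟨r₁, r₂⟩, r₃⟩, r₄⟩⟩
  simp only [Finset.prod_ite_zero, Finset.mem_univ, Finset.prod_const,
    Finset.card_univ, Fintype.card_fin, forall_and, forall_const]
  by_cases h : a₁ = r₁ ∧ b₂ = r₂ ∧ a₃ = b₃ ∧ a₄ = b₄ ∧ b₄ = r₄
  · obtain ⟨rfl, rfl, rfl, rfl, rfl⟩ := h
    have := labelled_apply (w := fun _ => (((1 / √2 : ℝ) ^ (m₁ + m₂ + m₃ + m₄) : ℝ) : ℂ))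
      (isFamily_eprGhz (m₁ := m₁) (m₂ := m₂) (m₃ := m₃) (m₄ := m₄) Finset.univ).injective
      (Finset.mem_univ (a₄, a₁, b₂, a₃))
    refine Eq.trans ?_ this.symm
    simp only [implies_true, if_true, and_self]
    push_cast
    ring
  · rw [labelled, Finset.sum_eq_zero]
    · simp only [funext_iff] at h
      rcases not_and_or.1 h with h | h
      · simp only [if_neg h, zero_mul]
      rcases not_and_or.1 h with h | h
      · simp only [if_neg h, zero_mul, mul_zero]
      rcases not_and_or.1 h with h | h
      · simp only [if_neg h, zero_mul, mul_zero]
      · simp only [if_neg h, mul_zero]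
    · rintro ⟨x, y₁, y₂, y₃⟩ _
      rw [if_neg]
      rintro ⟨h1, h2, h3⟩
      simp only [eprGhzA, eprGhzB, eprGhzR, Prod.mk.injEq] at h1 h2 h3
      exact h (by grind)

end Targets

/-! ### Tensor powers of ψ as a family -/

section Psi

/-- The four blocks of the labels `0, …, 5` of the system of `A`. -/
def blockA : Fin 6 → Fin 4 := ![0, 0, 1, 2, 2, 3]

/-- The three bits of `l` belong to the AR, BR and AB pairs, in this order. In `letterA`, `letterB`
and `letterR` each party's label depends only on the block and the two bits that it shares. -/
def letterA (l : Fin 4 × Fin 2 × Fin 2 × Fin 2) : Fin 6 :=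
  (![![0, 1] l.2.1, 2, ![3, 4] l.2.2.2, 5] : Fin 4 → Fin 6) l.1

def letterB (l : Fin 4 × Fin 2 × Fin 2 × Fin 2) : Fin 6 :=
  (![0, ![1, 2] l.2.2.1, ![3, 4] l.2.2.2, 5] : Fin 4 → Fin 6) l.1

def letterR (l : Fin 4 × Fin 2 × Fin 2 × Fin 2) : Fin 6 :=
  (![![0, 1] l.2.1, ![2, 3] l.2.2.1, 4, 5] : Fin 4 → Fin 6) l.1

/-- The seven terms of `psi`: a block, and a bit for each of the three kinds of EPR pairs that is
nonzero only in the block of its kind. -/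
def letters : Finset (Fin 4 × Fin 2 × Fin 2 × Fin 2) :=
  Finset.univ.filter fun l => (l.1 ≠ 0 → l.2.1 = 0) ∧ (l.1 ≠ 1 → l.2.2.1 = 0) ∧
    (l.1 ≠ 2 → l.2.2.2 = 0)

theorem letterA_eq_iff : ∀ l ∈ letters, ∀ l' ∈ letters,
    (letterA l = letterA l' ↔ l.1 = l'.1 ∧ l.2.1 = l'.2.1 ∧ l.2.2.2 = l'.2.2.2) := by
  decide

theorem letterB_eq_iff : ∀ l ∈ letters, ∀ l' ∈ letters,
    (letterB l = letterB l' ↔ l.1 = l'.1 ∧ l.2.2.1 = l'.2.2.1 ∧ l.2.2.2 = l'.2.2.2) := by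
  decide

theorem letterR_eq_iff : ∀ l ∈ letters, ∀ l' ∈ letters,
    (letterR l = letterR l' ↔ l.1 = l'.1 ∧ l.2.1 = l'.2.1 ∧ l.2.2.1 = l'.2.2.1) := by
  decide

/-- A alone can read off the block, so the type of a block sequence can be measured locally. -/
theorem blockA_letterA : ∀ l, blockA (letterA l) = l.1 := by
  decide

/-- The amplitude of each term of a block of `psi`. -/
def amp (c₁ c₂ c₃ c₄ : ℝ) : Fin 4 → ℝ := ![c₁ * (1 / √2), c₂ * (1 / √2), c₃ * (1 / √2), c₄]

theorem psi_vec (c₁ c₂ c₃ c₄ : ℝ) (p : Fin 6 × Fin 6 × Fin 6) :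
    (psi c₁ c₂ c₃ c₄).vec p = ∑ l ∈ letters,
      if letterA l = p.1 ∧ letterB l = p.2.1 ∧ letterR l = p.2.2 then
        (amp c₁ c₂ c₃ c₄ l.1 : ℂ) else 0 := by
  have h : letters = {(0, 0, 0, 0), (0, 1, 0, 0), (1, 0, 0, 0), (1, 0, 1, 0), (2, 0, 0, 0),
      (2, 0, 0, 1), (3, 0, 0, 0)} := by decide
  obtain ⟨a, b, r⟩ := p
  rw [h]
  simp [letterA, letterB, letterR, amp, ket, Pi.single_apply, eq_comm (b := a),
    eq_comm (b := b), eq_comm (b := r)]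
  ring_nf
  congr!

variable {n : ℕ}

/-- The bit strings that are nonzero only at positions in block `i`. -/
def blockBits (i : Fin 4) (x : Fin n → Fin 4) : Finset (Fin n → Fin 2) :=
  Fintype.piFinset fun j => if x j = i then Finset.univ else {0}

theorem mem_blockBits {i : Fin 4} {x : Fin n → Fin 4} {y : Fin n → Fin 2} :
    y ∈ blockBits i x ↔ ∀ j, x j ≠ i → y j = 0 := by
  simp only [blockBits, Fintype.mem_piFinset]
  refine forall_congr' fun j => ?_
  by_cases h : x j = i <;> simp [h]

/-- The number of positions in block `i`. -/
def blockCount (i : Fin 4) (x : Fin n → Fin 4) : ℕ := (Finset.univ.filter fun j => x j = i).card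

theorem card_blockBits (i : Fin 4) (x : Fin n → Fin 4) :
    (blockBits i x).card = 2 ^ blockCount i x := by
  rw [blockBits, Fintype.card_piFinset]
  simp [apply_ite, Finset.prod_ite, blockCount]

abbrev PsiIdx (n : ℕ) : Type :=
  (Fin n → Fin 4) × (Fin n → Fin 2) × (Fin n → Fin 2) × (Fin n → Fin 2)

abbrev psiSet (G : Finset (Fin n → Fin 4)) : Finset (PsiIdx n) :=
  familySet G (blockBits 0) (blockBits 1) (blockBits 2)

def PsiIdx.letter (ω : PsiIdx n) (j : Fin n) : Fin 4 × Fin 2 × Fin 2 × Fin 2 :=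
  (ω.1 j, ω.2.1 j, ω.2.2.1 j, ω.2.2.2 j)

theorem mem_psiSet {G : Finset (Fin n → Fin 4)} {ω : PsiIdx n} :
    ω ∈ psiSet G ↔ ω.1 ∈ G ∧ ∀ j, ω.letter j ∈ letters := by
  simp only [mem_familySet, mem_blockBits, PsiIdx.letter, letters, Finset.mem_filter,
    Finset.mem_univ, true_and, forall_and]

def psiA (ω : PsiIdx n) (j : Fin n) : Fin 6 := letterA (ω.letter j)

def psiB (ω : PsiIdx n) (j : Fin n) : Fin 6 := letterB (ω.letter j)

def psiR (ω : PsiIdx n) (j : Fin n) : Fin 6 := letterR (ω.letter j)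

variable (c₁ c₂ c₃ c₄ : ℝ)

/-- Sequences agree if and only if they agree at each position, where the finite checks on `letters`
apply. -/
theorem isFamily_psi (G : Finset (Fin n → Fin 4)) :
    IsFamily (S := ((psi c₁ c₂ c₃ c₄).pow n).sys) (psiSet G) psiA psiB psiR := by
  constructor
  · intro ω hω ω' hω'
    have h := fun j => letterA_eq_iff _ ((mem_psiSet.1 hω).2 j) _ ((mem_psiSet.1 hω').2 j)
    simp only [PsiIdx.letter] at h
    simp only [funext_iff, ← forall_and]
    exact forall_congr' h
  · intro ω hω ω' hω'
    have h := fun j => letterB_eq_iff _ ((mem_psiSet.1 hω).2 j) _ ((mem_psiSet.1 hω').2 j)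
    simp only [PsiIdx.letter] at h
    simp only [funext_iff, ← forall_and]
    exact forall_congr' h
  · intro ω hω ω' hω'
    have h := fun j => letterR_eq_iff _ ((mem_psiSet.1 hω).2 j) _ ((mem_psiSet.1 hω').2 j)
    simp only [PsiIdx.letter] at h
    simp only [funext_iff, ← forall_and]
    exact forall_congr' h

/-- The amplitude of the terms of `psi^{⊗ n}` with block sequence `x`. -/
def ampPow (x : Fin n → Fin 4) : ℝ := ∏ j, amp c₁ c₂ c₃ c₄ (x j)

theorem psi_pow_vec : ((psi c₁ c₂ c₃ c₄).pow n).vec =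
    labelled (S := ((psi c₁ c₂ c₃ c₄).pow n).sys) (psiSet Finset.univ) psiA psiB psiR
      fun ω => (ampPow c₁ c₂ c₃ c₄ ω.1 : ℂ) := by
  funext p
  have h : ((psi c₁ c₂ c₃ c₄).pow n).vec p =
      ∏ j, ∑ l ∈ letters, if letterA l = p.1 j ∧ letterB l = p.2.1 j ∧ letterR l = p.2.2 j then
        (amp c₁ c₂ c₃ c₄ l.1 : ℂ) else 0 :=
    (show _ = ∏ j, (psi c₁ c₂ c₃ c₄).vec (p.1 j, p.2.1 j, p.2.2 j) from rfl).trans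
      (Finset.prod_congr rfl fun j _ => psi_vec c₁ c₂ c₃ c₄ (p.1 j, p.2.1 j, p.2.2 j))
  rw [h, Finset.prod_univ_sum, labelled]
  refine Finset.sum_bij'
    (fun L _ => (fun j => (L j).1, fun j => (L j).2.1, fun j => (L j).2.2.1, fun j => (L j).2.2.2))
    (fun ω _ => ω.letter) (fun L hL => ?_) (fun ω hω => ?_) (fun _ _ => rfl) (fun _ _ => rfl)
    fun L hL => ?_
  · exact mem_psiSet.2 ⟨Finset.mem_univ _, Fintype.mem_piFinset.1 hL⟩
  · exact Fintype.mem_piFinset.2 (mem_psiSet.1 hω).2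
  · rw [Finset.prod_ite_zero]
    simp only [Finset.mem_univ, forall_true_left, forall_and, ampPow, Complex.ofReal_prod]
    refine if_congr ?_ rfl rfl
    simp only [funext_iff]
    rfl

/-- The probability of block `i`. -/
def prob : Fin 4 → ℝ := ![c₁ ^ 2, c₂ ^ 2, c₃ ^ 2, c₄ ^ 2]

/-- At each position in an EPR block, the two values of the free bit cancel the factor 1/2 in the
squared amplitude. -/
theorem ampPow_sq_mul (x : Fin n → Fin 4) :
    ampPow c₁ c₂ c₃ c₄ x ^ 2 * (2 ^ blockCount 0 x * 2 ^ blockCount 1 x * 2 ^ blockCount 2 x) =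
      ∏ j, prob c₁ c₂ c₃ c₄ (x j) := by
  have h : ∀ i, (2 : ℝ) ^ blockCount i x = ∏ j, if x j = i then 2 else 1 := by
    intro i
    simp [Finset.prod_ite, blockCount]
  rw [h, h, h, ampPow, ← Finset.prod_pow, ← Finset.prod_mul_distrib, ← Finset.prod_mul_distrib,
    ← Finset.prod_mul_distrib]
  refine Finset.prod_congr rfl fun j _ => ?_
  have : ∀ i, amp c₁ c₂ c₃ c₄ i ^ 2 * ((if i = 0 then 2 else 1) * (if i = 1 then 2 else 1) *
      (if i = 2 then 2 else 1)) = prob c₁ c₂ c₃ c₄ i := by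
    intro i
    fin_cases i <;> simp [amp, prob, mul_pow]
  exact this _

theorem prod_comp_eq_prod_pow_blockCount (f : Fin 4 → ℝ) (x : Fin n → Fin 4) :
    ∏ j, f (x j) = ∏ i, f i ^ blockCount i x := by
  rw [← Finset.prod_fiberwise' Finset.univ x f]
  simp [blockCount]

end Psi

/-! ### Overlaps, mixtures and normalisation -/

theorem labelled_family_inner {X Y₁ Y₂ Y₃ : Type} [Fintype X] [Fintype Y₁] [Fintype Y₂]
    [Fintype Y₃] [DecidableEq X] [DecidableEq Y₁] [DecidableEq Y₂] [DecidableEq Y₃]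
    {G G' : Finset X} {S₁ : X → Finset Y₁} {S₂ : X → Finset Y₂} {S₃ : X → Finset Y₃}
    {S : TriSystem} {α : X × Y₁ × Y₂ × Y₃ → S.A} {β : X × Y₁ × Y₂ × Y₃ → S.B}
    {ρ : X × Y₁ × Y₂ × Y₃ → S.R} (hf : IsFamily (familySet G S₁ S₂ S₃) α β ρ) (hG : G' ⊆ G)
    (a a' : X → ℂ) :
    star (labelled (familySet G S₁ S₂ S₃) α β ρ fun ω => a ω.1) ⬝ᵥ
      labelled (familySet G' S₁ S₂ S₃) α β ρ (fun ω => a' ω.1) =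
      ∑ x ∈ G', star (a x) * a' x * ((S₁ x).card * (S₂ x).card * (S₃ x).card) := by
  rw [← sum_familySet (fun x => star (a x) * a' x), ← labelled_inner (w := fun ω => a ω.1) ?_
    hf.injective]
  · rfl
  · intro ω hω
    rw [mem_familySet] at hω ⊢
    exact ⟨hG hω.1, hω.2⟩

theorem Reach.exists_discard (T : TriSystem) (hT : Nonempty T.Idx) :
    ∃ w : T.Idx → ℂ, star w ⬝ᵥ w = 1 ∧
      ∀ {S : TriSystem} (v : S.Idx → ℂ), Reach v T ((star v ⬝ᵥ v) • outer w) := by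
  obtain ⟨e⟩ := hT
  exact ⟨Pi.single e 1, by simp, fun v => Reach.discard v T e⟩

/-- The good outcomes cancel against |u⟩⟨u| and leave (|w⟩⟨w| - |u⟩⟨u|) times the bad probability.
-/
theorem traceNorm_mixture_sub_le {ι τ : Type*} [Fintype ι] [DecidableEq ι] [Fintype τ]
    [DecidableEq τ] {u w : ι → ℂ} (hu : star u ⬝ᵥ u = 1) (hw : star w ⬝ᵥ w = 1) {P : τ → ℝ}
    (hP0 : ∀ t, 0 ≤ P t) (hP1 : ∑ t, P t = 1) (good : Finset τ) :
    traceNorm ((∑ t, if t ∈ good then (P t : ℂ) • outer u else (P t : ℂ) • outer w) - outer u) ≤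
      2 * ∑ t ∈ goodᶜ, P t := by
  have hbad : ((∑ t ∈ goodᶜ, P t : ℝ) : ℂ) + ((∑ t ∈ good, P t : ℝ) : ℂ) = 1 := by
    rw [← Complex.ofReal_add, Finset.sum_compl_add_sum, hP1, Complex.ofReal_one]
  have heq : (∑ t, if t ∈ good then (P t : ℂ) • outer u else (P t : ℂ) • outer w) - outer u =
      ((∑ t ∈ goodᶜ, P t : ℝ) : ℂ) • (outer w - outer u) := by
    have hg : (Finset.univ.filter fun t => t ∈ good) = good := by simp
    have hg' : (Finset.univ.filter fun t => t ∉ good) = goodᶜ := by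
      ext; simp
    rw [Finset.sum_ite, hg, hg', ← Finset.sum_smul, ← Finset.sum_smul, ← Complex.ofReal_sum,
      ← Complex.ofReal_sum, eq_sub_of_add_eq' hbad, smul_sub, sub_smul, one_smul]
    abel
  rw [heq]
  refine (traceNorm_smul_outer_sub_le _ hw hu).trans ?_
  have h0 : 0 ≤ ∑ t ∈ goodᶜ, P t := Finset.sum_nonneg fun t _ => hP0 t
  rw [Complex.norm_real, Real.norm_eq_abs, abs_of_nonneg h0]
  refine (mul_le_mul_of_nonneg_left ?_ (mul_nonneg two_pos.le h0)).trans_eq (mul_one _)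
  rw [Real.sqrt_le_one]
  exact sub_le_self _ (sq_nonneg _)

theorem inv_sqrt_two_pow_mul_self (m : ℕ) :
    (((1 / √2 : ℝ) ^ m : ℝ) : ℂ) * (((1 / √2 : ℝ) ^ m : ℝ) : ℂ) * 2 ^ m = 1 := by
  have h : ((1 / √2 : ℝ) ^ m) * ((1 / √2 : ℝ) ^ m) * 2 ^ m = 1 := by
    rw [← mul_pow, ← mul_pow, one_div, ← mul_inv, Real.mul_self_sqrt (by norm_num)]
    norm_num
  exact_mod_cast congrArg (fun r : ℝ => (r : ℂ)) h

theorem eprGhzPow_normalized (m₁ m₂ m₃ m₄ : ℕ) :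
    ∑ _x ∈ (Finset.univ : Finset (Fin m₄ → Fin 2)),
      star (((1 / √2 : ℝ) ^ (m₁ + m₂ + m₃ + m₄) : ℝ) : ℂ) *
      (((1 / √2 : ℝ) ^ (m₁ + m₂ + m₃ + m₄) : ℝ) : ℂ) *
      ((Finset.univ : Finset (Fin m₁ → Fin 2)).card * (Finset.univ : Finset (Fin m₂ → Fin 2)).card *
        (Finset.univ : Finset (Fin m₃ → Fin 2)).card) = 1 := by
  refine Eq.trans ?_ (inv_sqrt_two_pow_mul_self (m₁ + m₂ + m₃ + m₄))
  simp only [Complex.star_def, Complex.conj_ofReal, Finset.sum_const, Finset.card_univ,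
    Fintype.card_pi, Fintype.card_fin, Finset.prod_const, nsmul_eq_mul]
  generalize (((1 / √2 : ℝ) ^ (m₁ + m₂ + m₃ + m₄) : ℝ) : ℂ) = κ
  push_cast
  ring

theorem eprGhzPow_norm (m₁ m₂ m₃ m₄ : ℕ) :
    star (eprGhzPow m₁ m₂ m₃ m₄).vec ⬝ᵥ (eprGhzPow m₁ m₂ m₃ m₄).vec = 1 := by
  have h := (labelled_family_inner (isFamily_eprGhz (m₁ := m₁) (m₂ := m₂) (m₃ := m₃) (m₄ := m₄)
    (familySet Finset.univ (fun _ => Finset.univ) (fun _ => Finset.univ) fun _ => Finset.univ))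
    subset_rfl (fun _ => (((1 / √2 : ℝ) ^ (m₁ + m₂ + m₃ + m₄) : ℝ) : ℂ))
    fun _ => (((1 / √2 : ℝ) ^ (m₁ + m₂ + m₃ + m₄) : ℝ) : ℂ)).trans
    (eprGhzPow_normalized m₁ m₂ m₃ m₄)
  rw [familySet_univ] at h
  exact (congrArg (fun v => star v ⬝ᵥ v) eprGhzPow_vec).trans h

/-! ### The two protocols at fixed n -/

section

variable (c₁ c₂ c₃ c₄ : ℝ) {n : ℕ}

/-- The probability of the block sequence `x`. -/
def seqProb (x : Fin n → Fin 4) : ℝ := ∏ j, prob c₁ c₂ c₃ c₄ (x j)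

theorem prob_nonneg (i : Fin 4) : 0 ≤ prob c₁ c₂ c₃ c₄ i := by
  fin_cases i <;> simp [prob, sq_nonneg]

theorem seqProb_nonneg (x : Fin n → Fin 4) : 0 ≤ seqProb c₁ c₂ c₃ c₄ x :=
  Finset.prod_nonneg fun _ _ => prob_nonneg _ _ _ _ _

theorem sum_prob (hc : c₁ ^ 2 + c₂ ^ 2 + c₃ ^ 2 + c₄ ^ 2 = 1) : ∑ i, prob c₁ c₂ c₃ c₄ i = 1 := by
  simpa [prob, Fin.sum_univ_four] using hc

theorem sum_seqProb (hc : c₁ ^ 2 + c₂ ^ 2 + c₃ ^ 2 + c₄ ^ 2 = 1) :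
    ∑ x : Fin n → Fin 4, seqProb c₁ c₂ c₃ c₄ x = 1 := by
  simp only [seqProb]
  rw [← Fintype.piFinset_univ,
    ← Finset.prod_univ_sum (fun _ => Finset.univ) (fun _ i => prob c₁ c₂ c₃ c₄ i)]
  simp [sum_prob c₁ c₂ c₃ c₄ hc]

theorem ampPow_mul_self (x : Fin n → Fin 4) :
    star (ampPow c₁ c₂ c₃ c₄ x : ℂ) * (ampPow c₁ c₂ c₃ c₄ x : ℂ) *
      ((blockBits 0 x).card * (blockBits 1 x).card * (blockBits 2 x).card) =
      (seqProb c₁ c₂ c₃ c₄ x : ℂ) := by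
  simp only [card_blockBits, seqProb, ← ampPow_sq_mul, Complex.star_def, Complex.conj_ofReal]
  push_cast
  ring

theorem psi_pow_inner (G : Finset (Fin n → Fin 4)) (a : ℂ) :
    star ((psi c₁ c₂ c₃ c₄).pow n).vec ⬝ᵥ
      labelled (S := ((psi c₁ c₂ c₃ c₄).pow n).sys) (psiSet G) psiA psiB psiR
        (fun ω => (ampPow c₁ c₂ c₃ c₄ ω.1 : ℂ) * a) =
      (∑ x ∈ G, seqProb c₁ c₂ c₃ c₄ x : ℝ) * a := by
  rw [psi_pow_vec]
  refine (labelled_family_inner (isFamily_psi c₁ c₂ c₃ c₄ _) (Finset.subset_univ G)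
    (fun x => (ampPow c₁ c₂ c₃ c₄ x : ℂ)) (fun x => (ampPow c₁ c₂ c₃ c₄ x : ℂ) * a)).trans ?_
  rw [Complex.ofReal_sum, Finset.sum_mul]
  refine Finset.sum_congr rfl fun x _ => ?_
  rw [← ampPow_mul_self]
  ring

theorem psi_pow_norm (hc : c₁ ^ 2 + c₂ ^ 2 + c₃ ^ 2 + c₄ ^ 2 = 1) :
    star ((psi c₁ c₂ c₃ c₄).pow n).vec ⬝ᵥ ((psi c₁ c₂ c₃ c₄).pow n).vec = 1 := by
  have h := psi_pow_inner c₁ c₂ c₃ c₄ (Finset.univ : Finset (Fin n → Fin 4)) 1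
  simp only [mul_one] at h
  rw [← psi_pow_vec, sum_seqProb c₁ c₂ c₃ c₄ hc] at h
  rw [h, Complex.ofReal_one]

theorem one_half_pow_mul (m₁ m₂ m₃ m₄ : ℕ) :
    (((1 / √2 : ℝ) ^ (m₁ + m₂ + m₃ + m₄) : ℝ) : ℂ) *
      star (((1 / √2 : ℝ) ^ (m₁ + m₂ + m₃ + m₄) : ℝ) : ℂ) *
      ((2 ^ m₄ * 2 ^ m₁ * 2 ^ m₂ * 2 ^ m₃ : ℕ) : ℂ) = 1 := by
  refine Eq.trans ?_ (inv_sqrt_two_pow_mul_self (m₁ + m₂ + m₃ + m₄))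
  simp only [Complex.star_def, Complex.conj_ofReal]
  generalize (((1 / √2 : ℝ) ^ (m₁ + m₂ + m₃ + m₄) : ℝ) : ℂ) = κ
  push_cast
  ring

/-- The protocol prepares exactly the restriction of ψ^{⊗n} to G, rescaled by P^{-1/2} with P the
probability of G. Its overlap with ψ^{⊗n} is √P, which gives the error. -/
theorem exists_locc_dilute (hc : c₁ ^ 2 + c₂ ^ 2 + c₃ ^ 2 + c₄ ^ 2 = 1) (m₁ m₂ m₃ m₄ : ℕ)
    (G : Finset (Fin n → Fin 4)) (hG : 0 < ∑ x ∈ G, seqProb c₁ c₂ c₃ c₄ x)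
    (hcard : G.card ≤ 2 ^ m₄) (h₁ : ∀ x ∈ G, blockCount 0 x ≤ m₁)
    (h₂ : ∀ x ∈ G, blockCount 1 x ≤ m₂) (h₃ : ∀ x ∈ G, blockCount 2 x ≤ m₃) :
    ∃ Λ : LOCC ((psi c₁ c₂ c₃ c₄).pow n).sys (eprGhzPow m₁ m₂ m₃ m₄).sys,
      traceNorm (Λ.apply (eprGhzPow m₁ m₂ m₃ m₄).density - ((psi c₁ c₂ c₃ c₄).pow n).density) ≤
        2 * √(1 - ∑ x ∈ G, seqProb c₁ c₂ c₃ c₄ x) := by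
  set P := ∑ x ∈ G, seqProb c₁ c₂ c₃ c₄ x with hP
  have hne : G.Nonempty := by
    rw [Finset.nonempty_iff_ne_empty]
    rintro rfl
    exact hG.ne' (by simp [hP])
  have hsq : (P : ℂ) * ((√P : ℂ)⁻¹ * (√P : ℂ)⁻¹) = 1 := by
    rw [← mul_inv, ← Complex.ofReal_mul, Real.mul_self_sqrt hG.le, mul_inv_cancel₀]
    exact_mod_cast hG.ne'
  have hstar : star ((√P : ℂ)⁻¹) = (√P : ℂ)⁻¹ := by
    rw [← Complex.ofReal_inv, Complex.star_def, Complex.conj_ofReal]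
  have hnorm : ∑ x ∈ G, star ((ampPow c₁ c₂ c₃ c₄ x : ℂ) * (√P : ℂ)⁻¹) *
      ((ampPow c₁ c₂ c₃ c₄ x : ℂ) * (√P : ℂ)⁻¹) *
      ((blockBits 0 x).card * (blockBits 1 x).card * (blockBits 2 x).card) = 1 := by
    rw [← hsq, hP, Complex.ofReal_sum, Finset.sum_mul, ← hP]
    refine Finset.sum_congr rfl fun x _ => ?_
    rw [← ampPow_mul_self, star_mul', hstar]
    ring
  have key := Reach.family (((1 / √2 : ℝ) ^ (m₁ + m₂ + m₃ + m₄) : ℝ) : ℂ)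
    (isFamily_eprGhz (m₁ := m₁) (m₂ := m₂) (m₃ := m₃) (m₄ := m₄)
      (familySet Finset.univ (fun _ => Finset.univ) (fun _ => Finset.univ) fun _ => Finset.univ))
    (isFamily_psi c₁ c₂ c₃ c₄ G) (n := 2 ^ m₄) (s₁ := 2 ^ m₁) (s₂ := 2 ^ m₂) (s₃ := 2 ^ m₃)
    (by simp) (by simp) (by simp) (by simp) hne hcard
    (fun x _ => by rw [card_blockBits]; positivity)
    (fun x hx => by rw [card_blockBits]; exact Nat.pow_le_pow_right two_pos (h₁ x hx))
    (fun x _ => by rw [card_blockBits]; positivity)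
    (fun x hx => by rw [card_blockBits]; exact Nat.pow_le_pow_right two_pos (h₂ x hx))
    (fun x _ => by rw [card_blockBits]; positivity)
    (fun x hx => by rw [card_blockBits]; exact Nat.pow_le_pow_right two_pos (h₃ x hx)) hnorm
  rw [familySet_univ, ← eprGhzPow_vec, one_half_pow_mul, one_smul] at key
  obtain ⟨Λ, hΛ⟩ := key
  refine ⟨Λ, ?_⟩
  -- The sign is reversed so that the overlap appears with ψ^{⊗n} on the left, as in
  -- `psi_pow_inner`.
  have e : Λ.apply (eprGhzPow m₁ m₂ m₃ m₄).density - ((psi c₁ c₂ c₃ c₄).pow n).density =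
      (-1 : ℂ) • (outer ((psi c₁ c₂ c₃ c₄).pow n).vec - outer (labelled
        (S := ((psi c₁ c₂ c₃ c₄).pow n).sys) (psiSet G) psiA psiB psiR
        (fun ω => (ampPow c₁ c₂ c₃ c₄ ω.1 : ℂ) * (√P : ℂ)⁻¹))) := by
    rw [← hΛ, neg_one_smul, neg_sub]
    rfl
  rw [e]
  refine (traceNorm_smul_outer_sub_le _ (psi_pow_norm c₁ c₂ c₃ c₄ hc)
    ((labelled_family_inner (isFamily_psi c₁ c₂ c₃ c₄ G) subset_rfl _ _).trans hnorm)).trans_eq ?_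
  rw [psi_pow_inner, ← hP, ← Complex.ofReal_inv, ← Complex.ofReal_mul, Complex.norm_real,
    Real.norm_eq_abs, sq_abs, mul_pow, inv_pow, Real.sq_sqrt hG.le, sq,
    mul_inv_cancel_right₀ hG.ne']
  simp

theorem blockCount_lt (i : Fin 4) (x : Fin n → Fin 4) : blockCount i x < n + 1 :=
  Nat.lt_succ_of_le ((Finset.card_filter_le _ _).trans (by simp))

/-- The type of a block sequence: how often each block occurs. -/
def seqType (x : Fin n → Fin 4) (i : Fin 4) : Fin (n + 1) := ⟨blockCount i x, blockCount_lt i x⟩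

/-- The block sequences of a given type. -/
def typeClass (t : Fin 4 → Fin (n + 1)) : Finset (Fin n → Fin 4) :=
  Finset.univ.filter fun x => seqType x = t

theorem blockCount_of_mem {t : Fin 4 → Fin (n + 1)} {x : Fin n → Fin 4} (hx : x ∈ typeClass t)
    (i : Fin 4) : blockCount i x = t i := by
  rw [← (Finset.mem_filter.1 hx).2]
  rfl

theorem ampPow_eq_of_mem {t : Fin 4 → Fin (n + 1)} {x : Fin n → Fin 4} (hx : x ∈ typeClass t) :
    ampPow c₁ c₂ c₃ c₄ x = ∏ i, amp c₁ c₂ c₃ c₄ i ^ (t i : ℕ) := by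
  rw [ampPow, prod_comp_eq_prod_pow_blockCount]
  simp only [blockCount_of_mem hx]

theorem sum_typeClass (g : (Fin n → Fin 4) → ℝ) : ∑ t, ∑ x ∈ typeClass t, g x = ∑ x, g x :=
  Finset.sum_fiberwise Finset.univ seqType g

/-- The part of `psi^{⊗ n}` of type `t`. -/
def psiType (t : Fin 4 → Fin (n + 1)) : ((psi c₁ c₂ c₃ c₄).pow n).sys.Idx → ℂ :=
  labelled (S := ((psi c₁ c₂ c₃ c₄).pow n).sys) (psiSet (typeClass t)) psiA psiB psiR
    (fun ω => (ampPow c₁ c₂ c₃ c₄ ω.1 : ℂ))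

theorem psiType_norm (t : Fin 4 → Fin (n + 1)) :
    star (psiType c₁ c₂ c₃ c₄ t) ⬝ᵥ psiType c₁ c₂ c₃ c₄ t =
      (∑ x ∈ typeClass t, seqProb c₁ c₂ c₃ c₄ x : ℝ) := by
  refine (labelled_family_inner (isFamily_psi c₁ c₂ c₃ c₄ _) subset_rfl
    (fun x => (ampPow c₁ c₂ c₃ c₄ x : ℂ)) fun x => (ampPow c₁ c₂ c₃ c₄ x : ℂ)).trans ?_
  simp only [ampPow_mul_self, Complex.ofReal_sum]

/-- Amplitudes and numbers of free bits depend on x only through its type, so `psiType` is a family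
with constant amplitude and `Reach.family` applies. -/
theorem reach_psiType (t : Fin 4 → Fin (n + 1)) {m₁ m₂ m₃ m₄ : ℕ}
    (hcard : 2 ^ m₄ ≤ (typeClass t).card) (h₁ : m₁ ≤ t 0) (h₂ : m₂ ≤ t 1) (h₃ : m₃ ≤ t 2) :
    Reach (psiType c₁ c₂ c₃ c₄ t) (eprGhzPow m₁ m₂ m₃ m₄).sys
      (((∑ x ∈ typeClass t, seqProb c₁ c₂ c₃ c₄ x : ℝ) : ℂ) •
        outer (eprGhzPow m₁ m₂ m₃ m₄).vec) := by
  have hb : ∀ i, ∀ x ∈ typeClass t, (blockBits i x).card = 2 ^ (t i : ℕ) := fun i x hx => by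
    rw [card_blockBits, blockCount_of_mem hx]
  set κ : ℝ := ∏ i, amp c₁ c₂ c₃ c₄ i ^ (t i : ℕ) with hκ
  have h := Reach.family (κ : ℂ) (isFamily_psi c₁ c₂ c₃ c₄ (typeClass t))
    (isFamily_eprGhz (m₁ := m₁) (m₂ := m₂) (m₃ := m₃) (m₄ := m₄)
      (familySet Finset.univ (fun _ => Finset.univ) (fun _ => Finset.univ)
        fun _ => Finset.univ)) rfl
    (hb 0) (hb 1) (hb 2) Finset.univ_nonempty (by simpa using hcard)
    (by simp) (fun _ _ => by simpa using Nat.pow_le_pow_right two_pos h₁)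
    (by simp) (fun _ _ => by simpa using Nat.pow_le_pow_right two_pos h₂)
    (by simp) (fun _ _ => by simpa using Nat.pow_le_pow_right two_pos h₃)
    (eprGhzPow_normalized m₁ m₂ m₃ m₄)
  have hcoef : (κ : ℂ) * star (κ : ℂ) * ((typeClass t).card * 2 ^ (t 0 : ℕ) * 2 ^ (t 1 : ℕ) *
      2 ^ (t 2 : ℕ) : ℕ) = ((∑ x ∈ typeClass t, seqProb c₁ c₂ c₃ c₄ x : ℝ) : ℂ) := by
    simp only [Complex.ofReal_sum, ← ampPow_mul_self]
    rw [Finset.sum_congr rfl fun x hx => by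
      rw [ampPow_eq_of_mem c₁ c₂ c₃ c₄ hx, hb 0 x hx, hb 1 x hx, hb 2 x hx, ← hκ]]
    rw [Finset.sum_const, nsmul_eq_mul]
    push_cast
    ring
  rw [familySet_univ, ← eprGhzPow_vec, hcoef] at h
  rwa [psiType, labelled_congr (w' := fun _ => (κ : ℂ)) (fun _ _ => rfl) (fun _ _ => rfl)
    (fun _ _ => rfl) fun ω hω => by rw [ampPow_eq_of_mem c₁ c₂ c₃ c₄ (mem_psiSet.1 hω).1]]

/-- The type read off from the label of `A`. -/
def labelType (a : Fin n → Fin 6) : Fin 4 → Fin (n + 1) := seqType fun j => blockA (a j)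

theorem labelType_psiA (ω : PsiIdx n) : labelType (psiA ω) = seqType ω.1 := by
  simp only [labelType, psiA, blockA_letterA]
  rfl

/-- A measures the type with the projections onto labels a of given `labelType a`; outcome t leaves
the component `psiType` of that type. -/
theorem Reach.of_psiType {T : TriSystem} {σ : (Fin 4 → Fin (n + 1)) → T.Op}
    (h : ∀ t, Reach (psiType c₁ c₂ c₃ c₄ t) T (σ t)) :
    Reach ((psi c₁ c₂ c₃ c₄).pow n).vec T (∑ t, σ t) := by
  rw [psi_pow_vec]
  refine Reach.labelledA (fun _ a => a) (fun t a => if labelType a = t then 1 else 0)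
    (fun a a' => ?_) fun t => ?_
  · by_cases h : a = a'
    · subst h
      simp [apply_ite]
    · simp [h]
  · have hset : psiSet (typeClass t) = (psiSet (Finset.univ : Finset (Fin n → Fin 4))).filter
        fun ω => labelType (psiA ω) = t := by
      ext ω
      simp [mem_psiSet, labelType_psiA, typeClass, and_comm]
    have hlab : labelled (S := ((psi c₁ c₂ c₃ c₄).pow n).sys) (psiSet Finset.univ) psiA psiB psiR
        (fun ω => (if labelType (psiA ω) = t then 1 else 0) * (ampPow c₁ c₂ c₃ c₄ ω.1 : ℂ)) =
        psiType c₁ c₂ c₃ c₄ t := by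
      rw [psiType, hset, labelled_filter]
      simp only [ite_mul, one_mul, zero_mul]
    have := h t
    rw [← hlab] at this
    exact this

/-- After the type measurement, a good type yields the target exactly and a bad one a fixed product
state, so only the bad probability enters the error. -/
theorem exists_locc_distill (hc : c₁ ^ 2 + c₂ ^ 2 + c₃ ^ 2 + c₄ ^ 2 = 1) (m₁ m₂ m₃ m₄ : ℕ)
    (good : Finset (Fin 4 → Fin (n + 1))) (hcard : ∀ t ∈ good, 2 ^ m₄ ≤ (typeClass t).card)
    (h₁ : ∀ t ∈ good, m₁ ≤ t 0) (h₂ : ∀ t ∈ good, m₂ ≤ t 1) (h₃ : ∀ t ∈ good, m₃ ≤ t 2) :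
    ∃ Λ : LOCC (eprGhzPow m₁ m₂ m₃ m₄).sys ((psi c₁ c₂ c₃ c₄).pow n).sys,
      traceNorm (Λ.apply ((psi c₁ c₂ c₃ c₄).pow n).density - (eprGhzPow m₁ m₂ m₃ m₄).density) ≤
        2 * ∑ t ∈ goodᶜ, ∑ x ∈ typeClass t, seqProb c₁ c₂ c₃ c₄ x := by
  have hne : Nonempty (eprGhzPow m₁ m₂ m₃ m₄).sys.Idx :=
    let z : EprGhzIdx m₁ m₂ m₃ m₄ := 0
    ⟨(eprGhzA z, eprGhzB z, eprGhzR z)⟩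
  obtain ⟨w, hw, hdisc⟩ := Reach.exists_discard _ hne
  have key : Reach ((psi c₁ c₂ c₃ c₄).pow n).vec (eprGhzPow m₁ m₂ m₃ m₄).sys
      (∑ t, if t ∈ good then ((∑ x ∈ typeClass t, seqProb c₁ c₂ c₃ c₄ x : ℝ) : ℂ) •
        outer (eprGhzPow m₁ m₂ m₃ m₄).vec else
        ((∑ x ∈ typeClass t, seqProb c₁ c₂ c₃ c₄ x : ℝ) : ℂ) • outer w) := by
    refine Reach.of_psiType c₁ c₂ c₃ c₄ fun t => ?_
    split_ifs with ht
    · exact reach_psiType c₁ c₂ c₃ c₄ t (hcard t ht) (h₁ t ht) (h₂ t ht) (h₃ t ht)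
    · exact psiType_norm c₁ c₂ c₃ c₄ t ▸ hdisc (psiType c₁ c₂ c₃ c₄ t)
  obtain ⟨Λ, hΛ⟩ := key
  refine ⟨Λ, ?_⟩
  have h := traceNorm_mixture_sub_le (eprGhzPow_norm m₁ m₂ m₃ m₄) hw
    (fun t => Finset.sum_nonneg fun x _ => seqProb_nonneg c₁ c₂ c₃ c₄ x)
    ((sum_typeClass (n := n) (seqProb c₁ c₂ c₃ c₄)).trans (sum_seqProb c₁ c₂ c₃ c₄ hc)) good
  rw [← hΛ] at h
  exact h

end

/-! ### Typical sequences and typical types -/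

/-- The variance of a sum of independent centred variables. -/
theorem sum_prod_mul_sum_sq {ι : Type*} [Fintype ι] {p f : ι → ℝ} (hp : ∑ i, p i = 1)
    (hf : ∑ i, p i * f i = 0) (n : ℕ) :
    ∑ x : Fin n → ι, (∏ j, p (x j)) * (∑ j, f (x j)) ^ 2 = n * ∑ i, p i * f i ^ 2 := by
  induction n with
  | zero => simp
  | succ n ih =>
    have h1 : ∑ x : Fin n → ι, ∏ j, p (x j) = 1 := by
      classical
      rw [← Fintype.piFinset_univ, ← Finset.prod_univ_sum (fun _ => Finset.univ) (fun _ i => p i)]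
      simp [hp]
    rw [← (Fin.consEquiv fun _ => ι).sum_comp, Fintype.sum_prod_type]
    simp only [Fin.consEquiv_apply, Fin.prod_univ_succ, Fin.sum_univ_succ, Fin.cons_zero,
      Fin.cons_succ]
    -- Expanding the square with the first coordinate fixed to i; the cross term drops out after
    -- summation over i because f is centred.
    have h2 : ∀ i, ∑ x : Fin n → ι, p i * (∏ j, p (x j)) * (f i + ∑ j, f (x j)) ^ 2 =
        p i * f i ^ 2 + p i * f i * (2 * ∑ x : Fin n → ι, (∏ j, p (x j)) * ∑ j, f (x j)) +
          p i * (n * ∑ i, p i * f i ^ 2) := by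
      intro i
      rw [← ih, ← mul_one (p i * f i ^ 2), ← h1, Finset.mul_sum, Finset.mul_sum, Finset.mul_sum,
        Finset.mul_sum, ← Finset.sum_add_distrib, ← Finset.sum_add_distrib]
      exact Finset.sum_congr rfl fun x _ => by ring
    simp only [h2]
    rw [Finset.sum_add_distrib, Finset.sum_add_distrib, ← Finset.sum_mul, ← Finset.sum_mul, hf, hp]
    push_cast
    ring

section

variable (c₁ c₂ c₃ c₄ : ℝ) {n : ℕ}

theorem prob_le_one (hc : c₁ ^ 2 + c₂ ^ 2 + c₃ ^ 2 + c₄ ^ 2 = 1) (i : Fin 4) :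
    prob c₁ c₂ c₃ c₄ i ≤ 1 := by
  rw [← sum_prob c₁ c₂ c₃ c₄ hc]
  exact Finset.single_le_sum (fun i _ => prob_nonneg c₁ c₂ c₃ c₄ i) (Finset.mem_univ i)

/-- The count is a sum of independent indicators, and each centred indicator is at most 1 in
absolute value. -/
theorem sum_seqProb_mul_sq_le (hc : c₁ ^ 2 + c₂ ^ 2 + c₃ ^ 2 + c₄ ^ 2 = 1) (i : Fin 4) :
    ∑ x : Fin n → Fin 4, seqProb c₁ c₂ c₃ c₄ x *
      ((blockCount i x : ℝ) - n * prob c₁ c₂ c₃ c₄ i) ^ 2 ≤ n := by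
  have hp := sum_prob c₁ c₂ c₃ c₄ hc
  set p := prob c₁ c₂ c₃ c₄ with hpdef
  have hf : ∑ k, p k * ((if k = i then 1 else 0) - p i) = 0 := by
    simp [mul_sub, Finset.sum_sub_distrib, ← Finset.sum_mul, hp]
  have h := sum_prod_mul_sum_sq hp hf n
  have hx : ∀ x : Fin n → Fin 4, ∑ j, ((if x j = i then (1 : ℝ) else 0) - p i) =
      (blockCount i x : ℝ) - n * p i := by
    intro x
    simp [Finset.sum_sub_distrib, blockCount]
  simp only [hx] at h
  refine h.le.trans (mul_le_of_le_one_right (Nat.cast_nonneg n) ?_)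
  rw [← hp]
  refine Finset.sum_le_sum fun k _ => mul_le_of_le_one_right (prob_nonneg c₁ c₂ c₃ c₄ k) ?_
  have h0 : 0 ≤ p i := prob_nonneg c₁ c₂ c₃ c₄ i
  have h1 : p i ≤ 1 := prob_le_one c₁ c₂ c₃ c₄ hc i
  split_ifs <;> nlinarith

/-- The block sequences in which every block occurs about as often as expected. -/
def typicalSet (n : ℕ) (δ : ℝ) : Finset (Fin n → Fin 4) :=
  Finset.univ.filter fun x => ∀ i, |(blockCount i x : ℝ) - n * prob c₁ c₂ c₃ c₄ i| ≤ δ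

/-- Chebyshev's inequality for the sum of the squared deviations of the four counts, whence the
factor 4. -/
theorem sum_compl_typicalSet_le (hc : c₁ ^ 2 + c₂ ^ 2 + c₃ ^ 2 + c₄ ^ 2 = 1) {δ : ℝ} (hδ : 0 < δ) :
    ∑ x ∈ (typicalSet c₁ c₂ c₃ c₄ n δ)ᶜ, seqProb c₁ c₂ c₃ c₄ x ≤ 4 * (n / δ ^ 2) := by
  have hnn : ∀ x : Fin n → Fin 4, 0 ≤ seqProb c₁ c₂ c₃ c₄ x *
      ∑ i, ((blockCount i x : ℝ) - n * prob c₁ c₂ c₃ c₄ i) ^ 2 := fun x =>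
    mul_nonneg (seqProb_nonneg _ _ _ _ x) (Finset.sum_nonneg fun i _ => sq_nonneg _)
  have h1 : ∑ x ∈ (typicalSet c₁ c₂ c₃ c₄ n δ)ᶜ, seqProb c₁ c₂ c₃ c₄ x * δ ^ 2 ≤ 4 * n := by
    calc _ ≤ ∑ x ∈ (typicalSet c₁ c₂ c₃ c₄ n δ)ᶜ, seqProb c₁ c₂ c₃ c₄ x *
        ∑ i, ((blockCount i x : ℝ) - n * prob c₁ c₂ c₃ c₄ i) ^ 2 := by
          refine Finset.sum_le_sum fun x hx => mul_le_mul_of_nonneg_left ?_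
            (seqProb_nonneg _ _ _ _ x)
          simp only [typicalSet, Finset.mem_compl, Finset.mem_filter, Finset.mem_univ, true_and,
            not_forall, not_le] at hx
          obtain ⟨i, hi⟩ := hx
          refine le_trans ?_ (Finset.single_le_sum (fun i _ => sq_nonneg _) (Finset.mem_univ i))
          rw [← sq_abs ((blockCount i x : ℝ) - n * prob c₁ c₂ c₃ c₄ i)]
          exact pow_le_pow_left₀ hδ.le hi.le 2
      _ ≤ ∑ x : Fin n → Fin 4, seqProb c₁ c₂ c₃ c₄ x *
        ∑ i, ((blockCount i x : ℝ) - n * prob c₁ c₂ c₃ c₄ i) ^ 2 :=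
          Finset.sum_le_sum_of_subset_of_nonneg (Finset.subset_univ _) fun x _ _ => hnn x
      _ = ∑ i, ∑ x : Fin n → Fin 4, seqProb c₁ c₂ c₃ c₄ x *
        ((blockCount i x : ℝ) - n * prob c₁ c₂ c₃ c₄ i) ^ 2 := by
          simp only [Finset.mul_sum]
          exact Finset.sum_comm
      _ ≤ ∑ _i : Fin 4, (n : ℝ) :=
          Finset.sum_le_sum fun i _ => sum_seqProb_mul_sq_le c₁ c₂ c₃ c₄ hc i
      _ = 4 * n := by simp
  rw [← Finset.sum_mul] at h1
  rwa [← mul_div_assoc, le_div_iff₀ (by positivity)]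

/-- The entropy of the block distribution, in bits. -/
def blockEntropy : ℝ := ∑ i, prob c₁ c₂ c₃ c₄ i * -Real.logb 2 (prob c₁ c₂ c₃ c₄ i)

/-- The sum of the surprisals of the blocks that occur. -/
def surprisalSum : ℝ := ∑ i, -Real.logb 2 (prob c₁ c₂ c₃ c₄ i)

theorem surprisal_nonneg (hc : c₁ ^ 2 + c₂ ^ 2 + c₃ ^ 2 + c₄ ^ 2 = 1) (i : Fin 4) :
    0 ≤ -Real.logb 2 (prob c₁ c₂ c₃ c₄ i) :=
  neg_nonneg.2 (Real.logb_nonpos one_lt_two (prob_nonneg _ _ _ _ i) (prob_le_one _ _ _ _ hc i))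

theorem blockEntropy_nonneg (hc : c₁ ^ 2 + c₂ ^ 2 + c₃ ^ 2 + c₄ ^ 2 = 1) :
    0 ≤ blockEntropy c₁ c₂ c₃ c₄ :=
  Finset.sum_nonneg fun i _ => mul_nonneg (prob_nonneg _ _ _ _ i) (surprisal_nonneg _ _ _ _ hc i)

/-- Covers the degenerate case: with zero entropy there are no GHZ states to absorb a correction δ *
`surprisalSum`, but the correction vanishes too. Blocks of probability 0 contribute nothing since
`Real.logb 2 0 = 0`. -/
theorem surprisalSum_eq_zero (hc : c₁ ^ 2 + c₂ ^ 2 + c₃ ^ 2 + c₄ ^ 2 = 1)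
    (h : blockEntropy c₁ c₂ c₃ c₄ = 0) : surprisalSum c₁ c₂ c₃ c₄ = 0 := by
  rw [blockEntropy, Finset.sum_eq_zero_iff_of_nonneg fun i _ =>
    mul_nonneg (prob_nonneg _ _ _ _ i) (surprisal_nonneg _ _ _ _ hc i)] at h
  refine Finset.sum_eq_zero fun i hi => ?_
  rcases mul_eq_zero.1 (h i hi) with h | h
  · simp [h]
  · exact h

theorem logb_seqProb {x : Fin n → Fin 4} (hx : 0 < seqProb c₁ c₂ c₃ c₄ x) :
    -Real.logb 2 (seqProb c₁ c₂ c₃ c₄ x) =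
      ∑ i, blockCount i x * -Real.logb 2 (prob c₁ c₂ c₃ c₄ i) := by
  rw [seqProb, prod_comp_eq_prod_pow_blockCount] at hx ⊢
  rw [Real.logb_prod _ _ fun i hi => Finset.prod_ne_zero_iff.1 hx.ne' i hi, ← Finset.sum_neg_distrib]
  simp [Real.logb_pow]

/-- The surprisal of a sequence is linear in its block counts, so a deviation of at most δ in each
count costs at most δ times the sum of the coefficients. -/
theorem abs_logb_seqProb_le (hc : c₁ ^ 2 + c₂ ^ 2 + c₃ ^ 2 + c₄ ^ 2 = 1) {δ : ℝ}
    {x : Fin n → Fin 4} (hx : 0 < seqProb c₁ c₂ c₃ c₄ x) (ht : x ∈ typicalSet c₁ c₂ c₃ c₄ n δ) :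
    |-Real.logb 2 (seqProb c₁ c₂ c₃ c₄ x) - n * blockEntropy c₁ c₂ c₃ c₄| ≤
      δ * surprisalSum c₁ c₂ c₃ c₄ := by
  rw [logb_seqProb c₁ c₂ c₃ c₄ hx, blockEntropy, surprisalSum, Finset.mul_sum, Finset.mul_sum,
    ← Finset.sum_sub_distrib]
  refine (Finset.abs_sum_le_sum_abs _ _).trans (Finset.sum_le_sum fun i _ => ?_)
  rw [← mul_assoc, ← sub_mul, abs_mul, abs_of_nonneg (surprisal_nonneg _ _ _ _ hc i)]
  exact mul_le_mul_of_nonneg_right ((Finset.mem_filter.1 ht).2 i) (surprisal_nonneg _ _ _ _ hc i)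

theorem blockCount_eq_zero {x : Fin n → Fin 4} (hx : 0 < seqProb c₁ c₂ c₃ c₄ x) {i : Fin 4}
    (hi : prob c₁ c₂ c₃ c₄ i = 0) : blockCount i x = 0 := by
  rw [seqProb, prod_comp_eq_prod_pow_blockCount] at hx
  by_contra h
  exact hx.ne' (Finset.prod_eq_zero (Finset.mem_univ i) (by rw [hi, zero_pow h]))

/-- The typical block sequences of positive probability. -/
def typicalSupport (n : ℕ) (δ : ℝ) : Finset (Fin n → Fin 4) :=
  (typicalSet c₁ c₂ c₃ c₄ n δ).filter fun x => 0 < seqProb c₁ c₂ c₃ c₄ x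

theorem sum_typicalSupport (hc : c₁ ^ 2 + c₂ ^ 2 + c₃ ^ 2 + c₄ ^ 2 = 1) {δ : ℝ} (hδ : 0 < δ) :
    1 - 4 * (n / δ ^ 2) ≤ ∑ x ∈ typicalSupport c₁ c₂ c₃ c₄ n δ, seqProb c₁ c₂ c₃ c₄ x := by
  rw [typicalSupport, Finset.sum_filter_of_ne fun x _ h =>
    lt_of_le_of_ne (seqProb_nonneg _ _ _ _ x) h.symm, ← sum_seqProb c₁ c₂ c₃ c₄ hc,
    ← Finset.sum_add_sum_compl (typicalSet c₁ c₂ c₃ c₄ n δ)]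
  linarith [sum_compl_typicalSet_le c₁ c₂ c₃ c₄ (n := n) hc hδ]

/-- Each of these sequences has probability at least 2^{-m}, and the total probability is 1. -/
theorem card_typicalSupport_le (hc : c₁ ^ 2 + c₂ ^ 2 + c₃ ^ 2 + c₄ ^ 2 = 1) {δ : ℝ} {m : ℕ}
    (hm : n * blockEntropy c₁ c₂ c₃ c₄ + δ * surprisalSum c₁ c₂ c₃ c₄ ≤ m) :
    (typicalSupport c₁ c₂ c₃ c₄ n δ).card ≤ 2 ^ m := by
  have h1 : ∀ x ∈ typicalSupport c₁ c₂ c₃ c₄ n δ, ((2 : ℝ) ^ m)⁻¹ ≤ seqProb c₁ c₂ c₃ c₄ x := by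
    intro x hx
    obtain ⟨ht, hpos⟩ := Finset.mem_filter.1 hx
    have h := (abs_le.1 (abs_logb_seqProb_le c₁ c₂ c₃ c₄ hc hpos ht)).2
    have h' : (-(m : ℝ)) ≤ Real.logb 2 (seqProb c₁ c₂ c₃ c₄ x) := by linarith
    rw [Real.le_logb_iff_rpow_le one_lt_two hpos, Real.rpow_neg two_pos.le, Real.rpow_natCast] at h'
    exact h'
  have h2 : (typicalSupport c₁ c₂ c₃ c₄ n δ).card * ((2 : ℝ) ^ m)⁻¹ ≤ 1 := by
    rw [← sum_seqProb c₁ c₂ c₃ c₄ hc (n := n), ← nsmul_eq_mul]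
    exact (Finset.card_nsmul_le_sum _ _ _ h1).trans (Finset.sum_le_sum_of_subset_of_nonneg
      (Finset.subset_univ _) fun x _ _ => seqProb_nonneg _ _ _ _ x)
  rw [← div_eq_mul_inv, div_le_one (by positivity)] at h2
  exact_mod_cast h2

/-- The types of the typical sequences that do not have too small a probability. -/
def typicalTypes (n : ℕ) (δ ε : ℝ) : Finset (Fin 4 → Fin (n + 1)) :=
  Finset.univ.filter fun t => (∀ i, |((t i : ℕ) : ℝ) - n * prob c₁ c₂ c₃ c₄ i| ≤ δ) ∧
    ε ≤ ∑ x ∈ typeClass t, seqProb c₁ c₂ c₃ c₄ x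

/-- An excluded type either consists of atypical sequences or has probability below ε, and there are
(n+1)^4 candidate types. -/
theorem sum_compl_typicalTypes_le (hc : c₁ ^ 2 + c₂ ^ 2 + c₃ ^ 2 + c₄ ^ 2 = 1) {δ ε : ℝ}
    (hδ : 0 < δ) (hε : 0 ≤ ε) :
    ∑ t ∈ (typicalTypes c₁ c₂ c₃ c₄ n δ ε)ᶜ, ∑ x ∈ typeClass t, seqProb c₁ c₂ c₃ c₄ x ≤
      4 * (n / δ ^ 2) + (n + 1) ^ 4 * ε := by
  have h : ∀ t ∈ (typicalTypes c₁ c₂ c₃ c₄ n δ ε)ᶜ, ∑ x ∈ typeClass t, seqProb c₁ c₂ c₃ c₄ x ≤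
      (∑ x ∈ typeClass t, if x ∈ (typicalSet c₁ c₂ c₃ c₄ n δ)ᶜ then seqProb c₁ c₂ c₃ c₄ x else 0)
        + ε := by
    intro t ht
    simp only [typicalTypes, Finset.mem_compl, Finset.mem_filter, Finset.mem_univ, true_and] at ht
    rcases not_and_or.1 ht with h | h
    · refine le_add_of_le_of_nonneg (Finset.sum_le_sum fun x hx => ?_) hε
      rw [if_pos]
      simpa [typicalSet, blockCount_of_mem hx] using h
    · refine (not_le.1 h).le.trans (le_add_of_nonneg_left (Finset.sum_nonneg fun x _ => ?_))
      split_ifs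
      · exact seqProb_nonneg _ _ _ _ x
      · exact le_rfl
  have hnn : ∀ t : Fin 4 → Fin (n + 1), 0 ≤ (∑ x ∈ typeClass t,
      if x ∈ (typicalSet c₁ c₂ c₃ c₄ n δ)ᶜ then seqProb c₁ c₂ c₃ c₄ x else 0) + ε := by
    refine fun t => add_nonneg (Finset.sum_nonneg fun x _ => ?_) hε
    split_ifs
    · exact seqProb_nonneg _ _ _ _ x
    · exact le_rfl
  refine (Finset.sum_le_sum h).trans ((Finset.sum_le_sum_of_subset_of_nonneg
    (Finset.subset_univ _) fun t _ _ => hnn t).trans ?_)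
  rw [Finset.sum_add_distrib, sum_typeClass, Finset.sum_ite_mem, Finset.univ_inter]
  refine add_le_add (sum_compl_typicalSet_le c₁ c₂ c₃ c₄ hc hδ) (le_of_eq ?_)
  simp

/-- All sequences of one type have the same probability q, so the class has at least ε / q elements,
and typicality bounds q from above. This replaces estimates of multinomial coefficients. For m = 0
it is enough that the class is nonempty. -/
theorem two_pow_le_card_typeClass (hc : c₁ ^ 2 + c₂ ^ 2 + c₃ ^ 2 + c₄ ^ 2 = 1) {δ ε : ℝ}
    (hε : 0 < ε) {t : Fin 4 → Fin (n + 1)} (ht : t ∈ typicalTypes c₁ c₂ c₃ c₄ n δ ε) {m : ℕ}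
    (hm : m = 0 ∨ m ≤ n * blockEntropy c₁ c₂ c₃ c₄ - δ * surprisalSum c₁ c₂ c₃ c₄ +
      Real.logb 2 ε) :
    2 ^ m ≤ (typeClass t).card := by
  obtain ⟨htyp, hP⟩ := (Finset.mem_filter.1 ht).2
  have hpos := hε.trans_le hP
  have hne : (typeClass t).Nonempty := by
    rw [Finset.nonempty_iff_ne_empty]
    intro h
    rw [h, Finset.sum_empty] at hpos
    exact hpos.false
  rcases hm with rfl | hm
  · simpa using hne.card_pos
  obtain ⟨x, hx⟩ := hne
  have hconst : ∀ y ∈ typeClass t, seqProb c₁ c₂ c₃ c₄ y = seqProb c₁ c₂ c₃ c₄ x := by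
    intro y hy
    simp only [seqProb, prod_comp_eq_prod_pow_blockCount, blockCount_of_mem hx,
      blockCount_of_mem hy]
  rw [Finset.sum_congr rfl hconst, Finset.sum_const, nsmul_eq_mul] at hpos hP
  have hq : 0 < seqProb c₁ c₂ c₃ c₄ x := pos_of_mul_pos_right hpos (Nat.cast_nonneg _)
  have hxt : x ∈ typicalSet c₁ c₂ c₃ c₄ n δ := by
    simpa [typicalSet, blockCount_of_mem hx] using htyp
  have h := (abs_le.1 (abs_logb_seqProb_le c₁ c₂ c₃ c₄ hc hq hxt)).1
  have hcard : (0 : ℝ) < (typeClass t).card := by exact_mod_cast Finset.card_pos.2 ⟨x, hx⟩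
  have h2 := Real.logb_le_logb_of_le one_lt_two hε hP
  rw [Real.logb_mul hcard.ne' hq.ne'] at h2
  have h3 : (m : ℝ) ≤ Real.logb 2 (typeClass t).card := by linarith
  rw [Real.le_logb_iff_rpow_le one_lt_two hcard, Real.rpow_natCast] at h3
  exact_mod_cast h3

end

/-! ### Choice of rates -/

open Filter Topology

theorem traceNorm_nonneg {ι : Type*} [Fintype ι] [DecidableEq ι] (M : Matrix ι ι ℂ) :
    0 ≤ traceNorm M :=
  Finset.sum_nonneg fun _ _ => Real.sqrt_nonneg _

theorem LOCC.nonempty (S T : TriSystem) (hT : Nonempty T.Idx) : Nonempty (LOCC T S) := by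
  obtain ⟨w, -, h⟩ := Reach.exists_discard T hT
  obtain ⟨Λ, -⟩ := h (0 : S.Idx → ℂ)
  exact ⟨Λ⟩

/-- Where no good protocol is available, an arbitrary one is used; this affects only finitely many
n, hence not the limit. -/
theorem AsympLOCCReducible.of_eventually {φ χ : ℕ → TriVector} {s : ℕ → ℕ} (hs : ∀ n, s n ≤ n)
    (hs0 : Tendsto (fun n => (s n : ℝ) / n) atTop (𝓝 0)) (hχ : ∀ n, Nonempty (χ n).sys.Idx)
    {err : ℕ → ℝ} (herr : Tendsto err atTop (𝓝 0))
    (h : ∀ᶠ n in atTop, ∃ Λ : LOCC (χ (n - s n)).sys (φ n).sys,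
      traceNorm (Λ.apply (φ n).density - (χ (n - s n)).density) ≤ err n) :
    AsympLOCCReducible φ χ := by
  have h' : ∀ n, ∃ Λ : LOCC (χ (n - s n)).sys (φ n).sys,
      (∃ Λ : LOCC (χ (n - s n)).sys (φ n).sys,
        traceNorm (Λ.apply (φ n).density - (χ (n - s n)).density) ≤ err n) →
      traceNorm (Λ.apply (φ n).density - (χ (n - s n)).density) ≤ err n := by
    intro n
    by_cases hn : ∃ Λ : LOCC (χ (n - s n)).sys (φ n).sys,
        traceNorm (Λ.apply (φ n).density - (χ (n - s n)).density) ≤ err n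
    · exact hn.imp fun _ h _ => h
    · obtain ⟨Λ⟩ := LOCC.nonempty (φ n).sys _ (hχ (n - s n))
      exact ⟨Λ, fun h => absurd h hn⟩
  choose Λ hΛ using h'
  exact ⟨s, hs, hs0, Λ, squeeze_zero' (Eventually.of_forall fun _ => traceNorm_nonneg _)
    (h.mono fun n hn => hΛ n hn) herr⟩

/-- The sublinear loss `⌈n^{7/8}⌉`. -/
def loss (n : ℕ) : ℕ := ⌈(n : ℝ) ^ (7 / 8 : ℝ)⌉₊

/-- The allowed deviation `n^{3/4}` of the counts from their expectations. -/
def deviation (n : ℕ) : ℝ := (n : ℝ) ^ (3 / 4 : ℝ)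

theorem loss_le (n : ℕ) : loss n ≤ n := by
  refine Nat.ceil_le.2 ?_
  rcases Nat.eq_zero_or_pos n with rfl | h
  · norm_num
  · exact (Real.rpow_le_rpow_of_exponent_le (by exact_mod_cast h) (by norm_num)).trans_eq
      (Real.rpow_one _)

theorem tendsto_natCast_rpow_neg {a : ℝ} (ha : 0 < a) :
    Tendsto (fun n : ℕ => (n : ℝ) ^ (-a)) atTop (𝓝 0) :=
  (tendsto_rpow_neg_atTop ha).comp tendsto_natCast_atTop_atTop

theorem tendsto_loss_div : Tendsto (fun n => (loss n : ℝ) / n) atTop (𝓝 0) := by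
  have h := (tendsto_natCast_rpow_neg (a := 1 / 8) (by norm_num)).add
    (tendsto_natCast_rpow_neg (a := 1) (by norm_num))
  rw [add_zero] at h
  refine squeeze_zero' (Eventually.of_forall fun n => by positivity) ?_ h
  filter_upwards [eventually_gt_atTop 0] with n hn
  have hn' : (0 : ℝ) < n := by exact_mod_cast hn
  rw [div_le_iff₀ hn', add_mul, ← Real.rpow_add_one hn'.ne', ← Real.rpow_add_one hn'.ne']
  refine (Nat.ceil_lt_add_one (Real.rpow_nonneg hn'.le _)).le.trans_eq ?_
  norm_num

theorem tendsto_div_deviation_sq : Tendsto (fun n : ℕ => (n : ℝ) / deviation n ^ 2) atTop (𝓝 0) := by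
  refine (tendsto_natCast_rpow_neg (a := 1 / 2) (by norm_num)).congr' ?_
  filter_upwards [eventually_gt_atTop 0] with n hn
  have hn' : (0 : ℝ) < n := by exact_mod_cast hn
  rw [deviation, eq_div_iff (by positivity), ← Real.rpow_natCast, ← Real.rpow_mul hn'.le,
    ← Real.rpow_add hn']
  norm_num

/-- The exponents satisfy 1/2 < 3/4 < 7/8 < 1: the deviation exceeds the standard deviation, the
loss exceeds the deviation and the logarithm, and the loss is still sublinear. -/
theorem eventually_le_mul_loss {a : ℝ} (ha : 0 < a) (C : ℝ) :
    ∀ᶠ n : ℕ in atTop, C * deviation n + 5 * Real.logb 2 (n + 1) + 1 ≤ a * loss n := by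
  have hcast := tendsto_natCast_atTop_atTop (R := ℝ)
  have h1 : Tendsto (fun n : ℕ => deviation n / (n : ℝ) ^ (7 / 8 : ℝ)) atTop (𝓝 0) := by
    refine (tendsto_natCast_rpow_neg (a := 1 / 8) (by norm_num)).congr' ?_
    filter_upwards [eventually_gt_atTop 0] with n hn
    have hn' : (0 : ℝ) < n := by exact_mod_cast hn
    rw [deviation, ← Real.rpow_sub hn']
    norm_num
  have h2 : Tendsto (fun n : ℕ => Real.logb 2 (n + 1) / (n : ℝ) ^ (7 / 8 : ℝ)) atTop (𝓝 0) := by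
    have hl := ((isLittleO_log_rpow_atTop (r := 7 / 8) (by norm_num)).tendsto_div_nhds_zero.comp
      hcast)
    have h3 := (tendsto_natCast_rpow_neg (a := 7 / 8) (by norm_num)).const_mul (Real.log 2)
    have h4 := (hl.add h3).const_mul (Real.log 2)⁻¹
    rw [mul_zero, add_zero, mul_zero] at h4
    refine squeeze_zero' (Eventually.of_forall fun n => div_nonneg
      (Real.logb_nonneg one_lt_two (by simp)) (by positivity)) ?_ h4
    filter_upwards [eventually_gt_atTop 0] with n hn
    have hn' : (1 : ℝ) ≤ n := by exact_mod_cast hn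
    have hn0 : (0 : ℝ) < n := by linarith
    have hlog : Real.log (n + 1) ≤ Real.log n + Real.log 2 := by
      rw [← Real.log_mul hn0.ne' two_ne_zero]
      exact Real.log_le_log (by linarith) (by linarith)
    have h2 : 0 < Real.log 2 := Real.log_pos one_lt_two
    have hpow : 0 < (n : ℝ) ^ (7 / 8 : ℝ) := by positivity
    simp only [Function.comp_apply, Real.rpow_neg hn0.le, Real.logb]
    rw [div_div, div_le_iff₀ (by positivity)]
    refine hlog.trans_eq ?_
    field_simp
  have h3 := tendsto_natCast_rpow_neg (a := 7 / 8) (by norm_num)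
  have h := ((h1.const_mul C).add (h2.const_mul 5)).add h3
  simp only [mul_zero, add_zero] at h
  filter_upwards [h.eventually (gt_mem_nhds ha), eventually_gt_atTop 0] with n hn hn0
  have hn' : (0 : ℝ) < n := by exact_mod_cast hn0
  have hpow : 0 < (n : ℝ) ^ (7 / 8 : ℝ) := by positivity
  have hle : (n : ℝ) ^ (7 / 8 : ℝ) ≤ loss n := Nat.le_ceil _
  rw [Real.rpow_neg hn'.le, mul_div_assoc', mul_div_assoc', ← one_div, ← add_div, ← add_div,
    div_lt_iff₀ hpow] at hn
  exact hn.le.trans (mul_le_mul_of_nonneg_left hle ha.le)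

/-! ### The two asymptotic reductions -/

section

variable (c₁ c₂ c₃ c₄ : ℝ)

theorem reducible_psi_eprGhz (hc : c₁ ^ 2 + c₂ ^ 2 + c₃ ^ 2 + c₄ ^ 2 = 1) :
    AsympLOCCReducible (fun n => (psi c₁ c₂ c₃ c₄).pow n)
      (eprGhz (c₁ ^ 2) (c₂ ^ 2) (c₃ ^ 2) (blockEntropy c₁ c₂ c₃ c₄)) := by
  have hp0 := prob_nonneg c₁ c₂ c₃ c₄
  have hH0 := blockEntropy_nonneg c₁ c₂ c₃ c₄ hc
  have herr : Tendsto (fun n : ℕ => 2 * (4 * ((n : ℝ) / deviation n ^ 2) + 1 / ((n : ℝ) + 1)))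
      atTop (𝓝 0) := by
    simpa using ((tendsto_div_deviation_sq.const_mul 4).add
      tendsto_one_div_add_atTop_nhds_zero_nat).const_mul 2
  refine AsympLOCCReducible.of_eventually loss_le tendsto_loss_div
    (fun n => ⟨(eprGhzA 0, eprGhzB 0, eprGhzR 0)⟩) herr ?_
  -- A rate equal to 0 gains nothing from the loss, so it is treated apart: no pair of that kind is
  -- then requested.
  have hev : ∀ i, ∀ᶠ n : ℕ in atTop, prob c₁ c₂ c₃ c₄ i = 0 ∨
      deviation n ≤ prob c₁ c₂ c₃ c₄ i * loss n := by
    intro i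
    rcases (hp0 i).eq_or_lt with h | h
    · exact Eventually.of_forall fun _ => Or.inl h.symm
    · filter_upwards [eventually_le_mul_loss h 1] with n hn
      have : 0 ≤ Real.logb 2 ((n : ℝ) + 1) := Real.logb_nonneg one_lt_two (by simp)
      right
      linarith
  have hevH : ∀ᶠ n : ℕ in atTop, blockEntropy c₁ c₂ c₃ c₄ = 0 ∨
      surprisalSum c₁ c₂ c₃ c₄ * deviation n + 5 * Real.logb 2 (n + 1) ≤
        blockEntropy c₁ c₂ c₃ c₄ * loss n := by
    rcases hH0.eq_or_lt with h | h
    · exact Eventually.of_forall fun _ => Or.inl h.symm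
    · filter_upwards [eventually_le_mul_loss h (surprisalSum c₁ c₂ c₃ c₄)] with n hn
      right
      linarith
  filter_upwards [eventually_all.2 hev, hevH, eventually_gt_atTop 0] with n hn hnH hn0
  have hδ : 0 < deviation n := Real.rpow_pos_of_pos (by exact_mod_cast hn0) _
  have hcast : ((n - loss n : ℕ) : ℝ) = n - loss n := Nat.cast_sub (loss_le n)
  -- With ε = (n+1)^{-5} the (n+1)^4 types cost at most 1/(n+1) in probability, and -log₂ ε = 5
  -- log₂(n+1) is absorbed by the loss.
  have hε : (0 : ℝ) < ((n + 1 : ℝ) ^ 5)⁻¹ := by positivity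
  have hm : ∀ t ∈ typicalTypes c₁ c₂ c₃ c₄ n (deviation n) ((n + 1 : ℝ) ^ 5)⁻¹, ∀ i,
      ⌊prob c₁ c₂ c₃ c₄ i * (n - loss n : ℕ)⌋₊ ≤ t i := by
    intro t ht i
    have h := (abs_le.1 ((Finset.mem_filter.1 ht).2.1 i)).1
    refine Nat.floor_le_of_le ?_
    rcases hn i with h0 | h0
    · rw [h0, zero_mul]
      exact Nat.cast_nonneg _
    · rw [hcast]
      linarith
  have hm₄ : ⌊blockEntropy c₁ c₂ c₃ c₄ * (n - loss n : ℕ)⌋₊ = 0 ∨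
      (⌊blockEntropy c₁ c₂ c₃ c₄ * (n - loss n : ℕ)⌋₊ : ℝ) ≤ n * blockEntropy c₁ c₂ c₃ c₄ -
        deviation n * surprisalSum c₁ c₂ c₃ c₄ + Real.logb 2 ((n + 1 : ℝ) ^ 5)⁻¹ := by
    rcases hnH with h | h
    · left
      rw [h, zero_mul, Nat.floor_zero]
    · right
      refine (Nat.floor_le (by positivity)).trans ?_
      rw [Real.logb_inv, Real.logb_pow, hcast]
      push_cast
      linarith
  obtain ⟨Λ, hΛ⟩ := exists_locc_distill c₁ c₂ c₃ c₄ hc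
    ⌊c₁ ^ 2 * (n - loss n : ℕ)⌋₊ ⌊c₂ ^ 2 * (n - loss n : ℕ)⌋₊ ⌊c₃ ^ 2 * (n - loss n : ℕ)⌋₊
    ⌊blockEntropy c₁ c₂ c₃ c₄ * (n - loss n : ℕ)⌋₊
    (typicalTypes c₁ c₂ c₃ c₄ n (deviation n) ((n + 1 : ℝ) ^ 5)⁻¹)
    (fun t ht => two_pow_le_card_typeClass c₁ c₂ c₃ c₄ hc hε ht hm₄)
    (fun t ht => hm t ht 0) (fun t ht => hm t ht 1) (fun t ht => hm t ht 2)
  refine ⟨Λ, hΛ.trans (mul_le_mul_of_nonneg_left ?_ two_pos.le)⟩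
  refine (sum_compl_typicalTypes_le c₁ c₂ c₃ c₄ hc hδ hε.le).trans_eq ?_
  congr 1
  field_simp

theorem reducible_eprGhz_psi (hc : c₁ ^ 2 + c₂ ^ 2 + c₃ ^ 2 + c₄ ^ 2 = 1) :
    AsympLOCCReducible (eprGhz (c₁ ^ 2) (c₂ ^ 2) (c₃ ^ 2) (blockEntropy c₁ c₂ c₃ c₄))
      (fun n => (psi c₁ c₂ c₃ c₄).pow n) := by
  have hp0 := prob_nonneg c₁ c₂ c₃ c₄
  have hH0 := blockEntropy_nonneg c₁ c₂ c₃ c₄ hc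
  have herr : Tendsto (fun n : ℕ => 2 * √(4 * ((n : ℝ) / deviation n ^ 2))) atTop (𝓝 0) := by
    simpa using ((tendsto_div_deviation_sq.const_mul 4).sqrt).const_mul 2
  refine AsympLOCCReducible.of_eventually loss_le tendsto_loss_div
    (fun n => ⟨(fun _ => 0, fun _ => 0, fun _ => 0)⟩) herr ?_
  have hev : ∀ i, ∀ᶠ n : ℕ in atTop, prob c₁ c₂ c₃ c₄ i = 0 ∨
      deviation n ≤ prob c₁ c₂ c₃ c₄ i * loss n := by
    intro i
    rcases (hp0 i).eq_or_lt with h | h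
    · exact Eventually.of_forall fun _ => Or.inl h.symm
    · filter_upwards [eventually_le_mul_loss h 1] with n hn
      have : 0 ≤ Real.logb 2 ((n : ℝ) + 1) := Real.logb_nonneg one_lt_two (by simp)
      right
      linarith
  -- The summand 1 pays for rounding down the number of available GHZ states.
  have hevH : ∀ᶠ n : ℕ in atTop, blockEntropy c₁ c₂ c₃ c₄ = 0 ∨
      surprisalSum c₁ c₂ c₃ c₄ * deviation n + 1 ≤ blockEntropy c₁ c₂ c₃ c₄ * loss n := by
    rcases hH0.eq_or_lt with h | h
    · exact Eventually.of_forall fun _ => Or.inl h.symm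
    · filter_upwards [eventually_le_mul_loss h (surprisalSum c₁ c₂ c₃ c₄)] with n hn
      have : 0 ≤ Real.logb 2 ((n : ℝ) + 1) := Real.logb_nonneg one_lt_two (by simp)
      right
      linarith
  -- Makes 1 - 4n/δ² positive, so the typical support has positive probability and the restricted
  -- vector can be normalised.
  have hsmall : ∀ᶠ n : ℕ in atTop, (n : ℝ) / deviation n ^ 2 < 1 / 4 :=
    tendsto_div_deviation_sq.eventually (gt_mem_nhds (by norm_num))
  filter_upwards [eventually_all.2 hev, hevH, hsmall, eventually_gt_atTop 0] with n hn hnH hns hn0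
  have hδ : 0 < deviation n := Real.rpow_pos_of_pos (by exact_mod_cast hn0) _
  have hcast : ((n - loss n : ℕ) : ℝ) = n - loss n := Nat.cast_sub (loss_le n)
  -- The target has length `n - loss n`, while the deviation is still the one belonging to n.
  have hkn : ((n - loss n : ℕ) : ℝ) / deviation n ^ 2 ≤ n / deviation n ^ 2 :=
    div_le_div_of_nonneg_right (by exact_mod_cast Nat.sub_le _ _) (by positivity)
  have hP := sum_typicalSupport c₁ c₂ c₃ c₄ (n := n - loss n) hc hδ
  have hm : ∀ x ∈ typicalSupport c₁ c₂ c₃ c₄ (n - loss n) (deviation n), ∀ i,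
      blockCount i x ≤ ⌊prob c₁ c₂ c₃ c₄ i * n⌋₊ := by
    intro x hx i
    obtain ⟨ht, hq⟩ := Finset.mem_filter.1 hx
    rcases hn i with h0 | h0
    · rw [blockCount_eq_zero c₁ c₂ c₃ c₄ hq h0]
      exact Nat.zero_le _
    · refine Nat.le_floor ?_
      have h := (abs_le.1 ((Finset.mem_filter.1 ht).2 i)).2
      rw [hcast] at h
      linarith
  have hm₄ : (n - loss n : ℕ) * blockEntropy c₁ c₂ c₃ c₄ +
      deviation n * surprisalSum c₁ c₂ c₃ c₄ ≤ (⌊blockEntropy c₁ c₂ c₃ c₄ * n⌋₊ : ℕ) := by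
    rcases hnH with h | h
    · rw [h, surprisalSum_eq_zero c₁ c₂ c₃ c₄ hc h]
      simp
    · have := (Nat.lt_floor_add_one (blockEntropy c₁ c₂ c₃ c₄ * n)).le
      rw [hcast]
      linarith
  obtain ⟨Λ, hΛ⟩ := exists_locc_dilute c₁ c₂ c₃ c₄ hc
    ⌊c₁ ^ 2 * n⌋₊ ⌊c₂ ^ 2 * n⌋₊ ⌊c₃ ^ 2 * n⌋₊ ⌊blockEntropy c₁ c₂ c₃ c₄ * n⌋₊
    (typicalSupport c₁ c₂ c₃ c₄ (n - loss n) (deviation n)) (by linarith)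
    (card_typicalSupport_le c₁ c₂ c₃ c₄ hc hm₄) (fun x hx => hm x hx 0) (fun x hx => hm x hx 1)
    (fun x hx => hm x hx 2)
  refine ⟨Λ, hΛ.trans (mul_le_mul_of_nonneg_left (Real.sqrt_le_sqrt ?_) two_pos.le)⟩
  linarith

end

end

theorem mainTheorem4 (c₁ c₂ c₃ c₄ : ℝ) (hc : c₁ ^ 2 + c₂ ^ 2 + c₃ ^ 2 + c₄ ^ 2 = 1) :
    AsympLOCCReversible
      (fun n => (psi c₁ c₂ c₃ c₄).pow n)
      (fun n => eprGhz (c₁ ^ 2) (c₂ ^ 2) (c₃ ^ 2)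
        (-(c₁ ^ 2 * Real.logb 2 (c₁ ^ 2) + c₂ ^ 2 * Real.logb 2 (c₂ ^ 2)
          + c₃ ^ 2 * Real.logb 2 (c₃ ^ 2) + c₄ ^ 2 * Real.logb 2 (c₄ ^ 2))) n) := by
  have h : -(c₁ ^ 2 * Real.logb 2 (c₁ ^ 2) + c₂ ^ 2 * Real.logb 2 (c₂ ^ 2)
      + c₃ ^ 2 * Real.logb 2 (c₃ ^ 2) + c₄ ^ 2 * Real.logb 2 (c₄ ^ 2)) =
      blockEntropy c₁ c₂ c₃ c₄ := by
    simp only [blockEntropy, prob, Fin.sum_univ_four, Matrix.cons_val]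
    ring
  rw [h]
  exact ⟨reducible_psi_eprGhz c₁ c₂ c₃ c₄ hc, reducible_eprGhz_psi c₁ c₂ c₃ c₄ hc⟩
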